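/- Let $\mathbb{T}^2=\mathbb{R}^2/\mathbb{Z}^2$ with normalised Lebesgue measure, and write $|\cdot|_p$ for the $L^p(\mathbb{T}^2)$-norm of real functions or (with the Euclidean norm pointwise) of vector fields. Let $\mathcal{E}$ be the space of real square integrable functions on $\mathbb{T}^2$ with zero mean. Let $W^{1,4}(\mathbb{T}^2)$ be the space of real $f\in L^4(\mathbb{T}^2)$ whose weak gradient $\nabla f$ is in $[L^4(\mathbb{T}^2)]^2$, with norm $\|f\|_{1,4}=\left(|f|_4^4+|\nabla f|_4^4\right)^{1/4}$. Let $K=\nabla^{\perp}G$, $\nabla^\perp=(-\partial_2,\partial_1)$, be the Biot--Savart kernel of $\mathbb{T}^2$, where $G$ is the mean-zero Green function with $\Delta G=\delta_0-1$. Thus $K*\xi$ is the vector field with Fourier series $$\sum_{k\in\mathbb{Z}^2\setminus\{0\}}\frac{i\,k^{\perp}}{2\pi|k|^2}\,\hat\xi(k)\,e^{2\pi i k\cdot x},\qquad k^\perp=(k_2,-k_1).$$ For $\xi\in W^{1,4}(\mathbb{T}^2)\cap\mathcal{E}$ and $\tau>0$, call $\Phi\in W^{1,4}(\mathbb{T}^2)\cap\mathcal{E}$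 a strong solution of $$\Phi=\xi-\tau\,(K*\xi)\cdot\nabla\Phi \tag{$*$}$$ if the equation holds almost everywhere on $\mathbb{T}^2$. **Lemma.** There is a constant $C>0$ such that for every $\xi\in W^{1,4}(\mathbb{T}^2)\cap\mathcal{E}$ and every $\tau>0$ with $C\tau\|\xi\|_{1,4}<1$, equation $(*)$ has a strong solution $\Phi_\tau(\xi)\in W^{1,4}(\mathbb{T}^2)\cap\mathcal{E}$, which is unique (up to equality almost everywhere) among strong solutions in $W^{1,4}(\mathbb{T}^2)\cap\mathcal{E}$, and $$\|\Phi_\tau(\xi)\|_{1,4}\le\left(1-C\tau\|\xi\|_{1,4}\right)^{-1/4}\|\xi\|_{1,4}.$$ -/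

import Mathlib

open MeasureTheory UnitAddTorus
open scoped ContDiff ENNReal

noncomputable section

/-- The two-dimensional torus `𝕋² = ℝ²/ℤ²`. -/
abbrev Torus2 : Type := UnitAddTorus (Fin 2)

/-- The Lebesgue (= normalised Haar) measure on `𝕋²`, of total mass one. -/
abbrev torusMeasure : Measure Torus2 := Measure.pi fun _ => AddCircle.haarAddCircle

/-- Vectors in the plane, with the Euclidean norm. -/
abbrev Vec2 : Type := EuclideanSpace ℝ (Fin 2)

/-- Smooth real functions on the torus: those whose `ℤ²`-periodic lift to `ℝ²` is `C^∞`. -/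
def SmoothTorus (φ : Torus2 → ℝ) : Prop :=
  ContDiff ℝ ∞ fun y : Fin 2 → ℝ => φ fun i => (y i : UnitAddCircle)

/-- The classical partial derivative `∂ᵢφ` of a function on the torus. -/
def torusPartial (i : Fin 2) (φ : Torus2 → ℝ) (x : Torus2) : ℝ :=
  deriv (fun s : ℝ => φ (x + Pi.single i (s : UnitAddCircle))) 0

/-- `g` is the weak (distributional) gradient of `f` on the torus. -/
def HasWeakGradient (f : Torus2 → ℝ) (g : Torus2 → Vec2) : Prop :=
  Integrable f torusMeasure ∧ Integrable g torusMeasure ∧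
    ∀ φ : Torus2 → ℝ, SmoothTorus φ → ∀ i : Fin 2,
      ∫ x, f x * torusPartial i φ x ∂torusMeasure = -∫ x, g x i * φ x ∂torusMeasure

open Classical in
/-- The weak gradient `∇f` (determined up to null sets; `0` if there is none). -/
def weakGradient (f : Torus2 → ℝ) : Torus2 → Vec2 :=
  if h : ∃ g, HasWeakGradient f g then h.choose else 0

/-- `f ∈ W^{1,4}(𝕋²)`: `f` is in `L⁴` and has a weak gradient in `L⁴`. -/
def MemW14 (f : Torus2 → ℝ) : Prop :=
  MemLp f 4 torusMeasure ∧ ∃ g, HasWeakGradient f g ∧ MemLp g 4 torusMeasure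

/-- The Sobolev norm `‖f‖_{1,4} = (|f|₄⁴ + |∇f|₄⁴)^{1/4}`. -/
def normW14 (f : Torus2 → ℝ) : ℝ :=
  ((∫ x, |f x| ^ 4 ∂torusMeasure) + ∫ x, ‖weakGradient f x‖ ^ 4 ∂torusMeasure) ^ (1 / 4 : ℝ)

/-- `f ∈ 𝓔`: `f` is square integrable with zero mean. -/
def MemE (f : Torus2 → ℝ) : Prop :=
  MemLp f 2 torusMeasure ∧ ∫ x, f x ∂torusMeasure = 0

/-- Components of `k^⊥ = (k₂, -k₁)`. -/
def perp (k : Fin 2 → ℤ) : Fin 2 → ℝ := ![(k 1 : ℝ), -(k 0 : ℝ)]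

/-- The Fourier coefficients of the Biot–Savart kernel `K = ∇^⊥ G` on the torus, where
`∇^⊥ = (-∂₂, ∂₁)` and `G` is the mean-zero Green function, `Δ G = δ₀ - 1`:
`K̂ⱼ(k) = i k^⊥ⱼ / (2π |k|²)` for `k ≠ 0` and `K̂(0) = 0` (the quotient is `0 / 0 = 0` there). -/
def biotSavartCoeff (j : Fin 2) (k : Fin 2 → ℤ) : ℂ :=
  Complex.I * (perp k j : ℂ) / (2 * Real.pi * ((k 0 : ℂ) ^ 2 + (k 1 : ℂ) ^ 2))

/-- The velocity `K * ξ` of a vorticity `ξ ∈ L²`: the convolution of `ξ` with the Biot–Savart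
kernel, i.e. the field with Fourier series `∑ₖ K̂(k) ξ̂(k) e^{2πik·x}`, which converges in `L²`
and is real. -/
def biotSavart (ξ : Torus2 → ℝ) (x : Torus2) : Vec2 :=
  WithLp.toLp 2 fun j : Fin 2 =>
    ((∑' k : Fin 2 → ℤ,
      (biotSavartCoeff j k * mFourierCoeff (fun y => (ξ y : ℂ)) k) • mFourierLp 2 k) x).re

/-- `Φ` is a strong solution in `W^{1,4} ∩ 𝓔` of `Φ = ξ - τ (K * ξ) · ∇Φ`:
the equation holds almost everywhere. -/
def IsStrongSolution (τ : ℝ) (ξ Φ : Torus2 → ℝ) : Prop :=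
  MemW14 Φ ∧ MemE Φ ∧
    ∀ᵐ x ∂torusMeasure, Φ x = ξ x - τ * ∑ j, biotSavart ξ x j * weakGradient Φ x j

end

/-!
Write `u = K * ξ`. The equation `Φ + τ u · ∇Φ = ξ` is a stationary transport equation with an
incompressible field, and it is solved in `W^{1,4}` because `∇u` is bounded by `‖ξ‖_{1,4}`.

*The velocity gradient.* On the Fourier side `∂ᵢuⱼ` is, up to a constant, the multiplier `k_l / |k|²`,
`l = 1 - j`, applied to `∂ᵢξ ∈ L⁴`. The kernels of this multiplier, truncated to
`|kᵢ| ≤ M`, are bounded uniformly in `M` as functionals on `L⁴`. Indeed, with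
`σ = |1 - e^{2πi xⱼ}|`, Abel summation in the frequency `kⱼ` and Parseval's identity in `x_l`
bound them in `L²(σ^{3/8})` (`exists_weighted_bound`), and Young's inequality with the weight `σ`
pairs them with `L⁴` functions (`exists_kernel_bound`). This gives
`|∂ᵢuⱼ| ≤ C |∇ξ|₄` for the truncated velocities, with `C` independent of `M`
(`exists_torusPartial_truncVel_bound`).

*Smooth fields.* For a smooth field `v` with `|∂ᵢvⱼ| ≤ L`, the operator `v · ∇` is approximated by
`(2c - P)/h`, where `P f` averages translates of `f` by `± h eᵢ` with the nonnegative weights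
`(c ± vᵢ)/2`. By Jensen's inequality `P` has norm at most `2c + 2hL` on `L⁴`, and its action on
gradients has norm at most `2c + 6hL`, so that the discrete equation is solved by iteration with
bounds `|f|₄ ≤ |ξ|₄ / (1 - 6τL)` and `|∇f|₄ ≤ |∇ξ|₄ / (1 - 6τL)`. A weak limit as `h → 0` solves
`f + τ v · ∇f = ξ` with the same bounds (`exists_solution_smooth`).

*Existence.* The truncated velocities are smooth and converge to `u` in `L²`, and the gradients of
the corresponding solutions are bounded in `L⁴`; the products pass to a weak limit
(`exists_solution`). Bernoulli's inequality `(1 - s)⁴ ≥ 1 - 4s` turns the bounds into the stated one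
(`rpow_four_le_of_le_div`).

*Mean and uniqueness.* As `u` is incompressible, `∫ u · ∇f = 0` and `∫ (u · ∇f) f = 0` for
`f ∈ W^{1,4}`, first for the truncated velocities and then in the limit. The former shows that a
solution has the mean of `ξ`; the latter gives `∫ D² = 0` for the difference `D` of two solutions
(`IsStrongSolution.ae_unique`).
-/

open Filter Topology

noncomputable section

/-! ### Smooth functions on the torus -/

/-- The covering map `ℝ² → 𝕋²`. -/
def toTorus (y : Fin 2 → ℝ) : Torus2 := fun i => (y i : UnitAddCircle)

/-- The point `s eᵢ` of the torus. -/
def axisStep (i : Fin 2) (s : ℝ) : Torus2 := Pi.single i (s : UnitAddCircle)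

lemma toTorus_add (y z : Fin 2 → ℝ) : toTorus (y + z) = toTorus y + toTorus z := by
  ext i; simp [toTorus]

lemma toTorus_smul_single (i : Fin 2) (s : ℝ) :
    toTorus (s • Pi.single i 1) = axisStep i s := by
  ext j
  by_cases h : j = i
  · subst h; simp [toTorus, axisStep]
  · simp [toTorus, axisStep, h]

lemma axisStep_add (i : Fin 2) (s t : ℝ) : axisStep i (s + t) = axisStep i s + axisStep i t := by
  simp [axisStep, Pi.single_add]

lemma axisStep_zero (i : Fin 2) : axisStep i 0 = 0 := by simp [axisStep]

lemma axisStep_neg (i : Fin 2) (s : ℝ) : axisStep i (-s) = -axisStep i s := by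
  simp [axisStep, Pi.single_neg]

lemma isOpenQuotientMap_toTorus : IsOpenQuotientMap toTorus :=
  IsOpenQuotientMap.piMap (fun _ => QuotientAddGroup.isOpenQuotientMap_mk)

lemma toTorus_surjective : Function.Surjective toTorus := isOpenQuotientMap_toTorus.surjective

lemma torusPartial_eq_of_hasDerivAt {φ : Torus2 → ℝ} {i : Fin 2} {x : Torus2} {d : ℝ}
    (h : HasDerivAt (fun s : ℝ => φ (x + axisStep i s)) d 0) : torusPartial i φ x = d :=
  h.deriv

namespace SmoothTorus

variable {φ ψ : Torus2 → ℝ}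

lemma lift (hφ : SmoothTorus φ) : ContDiff ℝ ∞ (fun y => φ (toTorus y)) := hφ

lemma continuous (hφ : SmoothTorus φ) : Continuous φ :=
  isOpenQuotientMap_toTorus.isQuotientMap.continuous_iff.2 hφ.lift.continuous

lemma const (c : ℝ) : SmoothTorus fun _ => c := contDiff_const

lemma add (hφ : SmoothTorus φ) (hψ : SmoothTorus ψ) : SmoothTorus fun x => φ x + ψ x :=
  ContDiff.add hφ.lift hψ.lift

lemma sub (hφ : SmoothTorus φ) (hψ : SmoothTorus ψ) : SmoothTorus fun x => φ x - ψ x :=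
  ContDiff.sub hφ.lift hψ.lift

lemma mul (hφ : SmoothTorus φ) (hψ : SmoothTorus ψ) : SmoothTorus fun x => φ x * ψ x :=
  ContDiff.mul hφ.lift hψ.lift

lemma const_mul (c : ℝ) (hφ : SmoothTorus φ) : SmoothTorus fun x => c * φ x :=
  (const c).mul hφ

lemma comp_add (hφ : SmoothTorus φ) (z : Torus2) : SmoothTorus fun x => φ (x + z) := by
  obtain ⟨w, rfl⟩ := toTorus_surjective z
  have : ContDiff ℝ ∞ (fun y : Fin 2 → ℝ => φ (toTorus (y + w))) :=
    hφ.lift.comp (contDiff_id.add contDiff_const)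
  simpa only [toTorus_add] using! this

lemma hasDerivAt_zero (hφ : SmoothTorus φ) (i : Fin 2) (y : Fin 2 → ℝ) :
    HasDerivAt (fun s : ℝ => φ (toTorus y + axisStep i s))
      (fderiv ℝ (fun y => φ (toTorus y)) y (Pi.single i 1)) 0 := by
  have h1 : HasFDerivAt (fun y => φ (toTorus y)) (fderiv ℝ (fun y => φ (toTorus y)) y) y :=
    (hφ.lift.differentiable (by simp) y).hasFDerivAt
  have h2 := h1.hasLineDerivAt (Pi.single i 1)
  simpa only [HasLineDerivAt, toTorus_add, toTorus_smul_single] using! h2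

lemma torusPartial_toTorus (hφ : SmoothTorus φ) (i : Fin 2) (y : Fin 2 → ℝ) :
    torusPartial i φ (toTorus y) = fderiv ℝ (fun y => φ (toTorus y)) y (Pi.single i 1) :=
  (hφ.hasDerivAt_zero i y).deriv

lemma torusPartial (hφ : SmoothTorus φ) (i : Fin 2) : SmoothTorus (torusPartial i φ) := by
  have h : ContDiff ℝ ∞ fun y => fderiv ℝ (fun y => φ (toTorus y)) y (Pi.single i 1) :=
    (hφ.lift.fderiv_right (m := ∞) (by simp)).clm_apply contDiff_const
  have h2 : (fun y => _root_.torusPartial i φ (toTorus y)) = _ :=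
    funext (hφ.torusPartial_toTorus i)
  exact (h2 ▸ h : ContDiff ℝ ∞ fun y => _root_.torusPartial i φ (toTorus y))

lemma hasDerivAt (hφ : SmoothTorus φ) (i : Fin 2) (x : Torus2) (s : ℝ) :
    HasDerivAt (fun s : ℝ => φ (x + axisStep i s))
      (_root_.torusPartial i φ (x + axisStep i s)) s := by
  obtain ⟨w, hw⟩ := toTorus_surjective (x + axisStep i s)
  have h := hφ.hasDerivAt_zero i w
  rw [← hφ.torusPartial_toTorus, hw] at h
  have h2 := HasDerivAt.comp_sub_const s s (f := fun s' : ℝ => φ (x + axisStep i s + axisStep i s'))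
    (by simpa using h)
  simpa only [add_assoc, ← axisStep_add, add_sub_cancel] using h2

lemma torusPartial_mul (hφ : SmoothTorus φ) (hψ : SmoothTorus ψ) (i : Fin 2) (x : Torus2) :
    _root_.torusPartial i (fun x => φ x * ψ x) x
      = _root_.torusPartial i φ x * ψ x + φ x * _root_.torusPartial i ψ x := by
  have h := (hφ.hasDerivAt i x 0).mul (hψ.hasDerivAt i x 0)
  refine torusPartial_eq_of_hasDerivAt ?_
  simpa only [axisStep_zero, add_zero] using! h

lemma torusPartial_add (hφ : SmoothTorus φ) (hψ : SmoothTorus ψ) (i : Fin 2) (x : Torus2) :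
    _root_.torusPartial i (fun x => φ x + ψ x) x
      = _root_.torusPartial i φ x + _root_.torusPartial i ψ x := by
  have h := (hφ.hasDerivAt i x 0).add (hψ.hasDerivAt i x 0)
  refine torusPartial_eq_of_hasDerivAt ?_
  simpa only [axisStep_zero, add_zero] using! h

lemma torusPartial_const_mul (c : ℝ) (hφ : SmoothTorus φ) (i : Fin 2) (x : Torus2) :
    _root_.torusPartial i (fun x => c * φ x) x = c * _root_.torusPartial i φ x := by
  have h := (hφ.hasDerivAt i x 0).const_mul c
  refine torusPartial_eq_of_hasDerivAt ?_
  simpa only [axisStep_zero, add_zero] using! h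

lemma torusPartial_comp_add (hφ : SmoothTorus φ) (z : Torus2) (i : Fin 2) (x : Torus2) :
    _root_.torusPartial i (fun x => φ (x + z)) x = _root_.torusPartial i φ (x + z) := by
  have h := hφ.hasDerivAt i (x + z) 0
  rw [axisStep_zero, add_zero] at h
  refine torusPartial_eq_of_hasDerivAt ?_
  simpa only [add_right_comm] using h

lemma exists_bound (hφ : SmoothTorus φ) : ∃ C, 0 ≤ C ∧ ∀ x, |φ x| ≤ C := by
  obtain ⟨C, hC⟩ := isCompact_univ.exists_bound_of_continuousOn hφ.continuous.continuousOn
  exact ⟨C, (abs_nonneg _).trans (hC 0 trivial), fun x => hC x trivial⟩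

/-- Mean value inequality along a coordinate axis. -/
lemma abs_increment_le (hφ : SmoothTorus φ) {i : Fin 2} {L : ℝ}
    (hL : ∀ x, |_root_.torusPartial i φ x| ≤ L) (x : Torus2) (t : ℝ) :
    |φ (x + axisStep i t) - φ x| ≤ L * |t| := by
  have := Convex.norm_image_sub_le_of_norm_hasDerivWithin_le (s := Set.univ) (C := L)
    (fun s _ => (hφ.hasDerivAt i x s).hasDerivWithinAt) (fun s _ => hL _) convex_univ
    (Set.mem_univ 0) (Set.mem_univ t)
  simpa [axisStep_zero] using this

/-- Second order Taylor bound along a coordinate axis, uniform in the base point. -/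
lemma exists_taylor_bound (hφ : SmoothTorus φ) (i : Fin 2) :
    ∃ C, 0 ≤ C ∧ ∀ x t,
      |φ (x + axisStep i t) - φ x - t * _root_.torusPartial i φ x| ≤ C * t ^ 2 := by
  obtain ⟨C, hC0, hC⟩ := ((hφ.torusPartial i).torusPartial i).exists_bound
  refine ⟨C, hC0, fun x t => ?_⟩
  have := Convex.norm_image_sub_le_of_norm_hasDerivWithin_le (s := Set.uIcc 0 t) (C := C * |t|)
    (f := fun s => φ (x + axisStep i s) - s * _root_.torusPartial i φ x)
    (f' := fun s => _root_.torusPartial i φ (x + axisStep i s) - 1 * _root_.torusPartial i φ x)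
    (fun s _ => ((hφ.hasDerivAt i x s).sub
      ((hasDerivAt_id s).mul_const _)).hasDerivWithinAt) (fun s hs => ?_) (convex_uIcc 0 t)
    Set.left_mem_uIcc Set.right_mem_uIcc
  · simp only [axisStep_zero, add_zero, Real.norm_eq_abs, sub_zero, zero_mul] at this
    rw [mul_assoc, abs_mul_abs_self] at this
    rw [pow_two]
    convert! this using 2
    ring
  · rw [one_mul, Real.norm_eq_abs]
    refine ((hφ.torusPartial i).abs_increment_le hC x s).trans ?_
    have : |s| ≤ |t| := by
      simpa using Set.abs_sub_left_of_mem_uIcc hs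
    gcongr

end SmoothTorus

lemma SmoothTorus.sum {ι : Type*} {s : Finset ι} {φ : ι → Torus2 → ℝ}
    (hφ : ∀ k ∈ s, SmoothTorus (φ k)) : SmoothTorus fun x => ∑ k ∈ s, φ k x :=
  ContDiff.sum (fun k hk => (hφ k hk).lift)

/-! ### Integration on the torus -/

lemma measurePreserving_add_torus (z : Torus2) :
    MeasurePreserving (fun x => x + z) torusMeasure torusMeasure :=
  measurePreserving_add_right torusMeasure z

lemma integral_add_torus {E : Type*} [NormedAddCommGroup E] [NormedSpace ℝ E]
    (f : Torus2 → E) (z : Torus2) :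
    ∫ x, f (x + z) ∂torusMeasure = ∫ x, f x ∂torusMeasure :=
  integral_add_right_eq_self f z

lemma SmoothTorus.memLp {φ : Torus2 → ℝ} (hφ : SmoothTorus φ) (p : ℝ≥0∞) :
    MemLp φ p torusMeasure := by
  obtain ⟨C, -, hC⟩ := hφ.exists_bound
  exact .of_bound hφ.continuous.aestronglyMeasurable C (.of_forall hC)

lemma SmoothTorus.integrable_mul {φ f : Torus2 → ℝ} (hφ : SmoothTorus φ)
    (hf : Integrable f torusMeasure) : Integrable (fun x => f x * φ x) torusMeasure := by
  obtain ⟨C, -, hC⟩ := hφ.exists_bound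
  exact hf.mul_bdd hφ.continuous.aestronglyMeasurable (.of_forall hC)

/-- Cauchy–Schwarz. -/
lemma abs_integral_inner_le {E : Type*} [NormedAddCommGroup E] [InnerProductSpace ℝ E]
    {f w : Torus2 → E}
    (hf : MemLp f 2 torusMeasure) (hw : MemLp w 2 torusMeasure) :
    |∫ x, inner ℝ (f x) (w x) ∂torusMeasure|
      ≤ lpNorm f 2 torusMeasure * lpNorm w 2 torusMeasure := by
  have h := abs_real_inner_le_norm (hf.toLp f) (hw.toLp w)
  rw [Lp.norm_toLp, Lp.norm_toLp, toReal_eLpNorm hf.1, toReal_eLpNorm hw.1, L2.inner_def] at h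
  convert h using 2
  refine integral_congr_ae ?_
  filter_upwards [hf.coeFn_toLp, hw.coeFn_toLp] with x h1 h2
  rw [h1, h2]

lemma abs_integral_mul_le {f w : Torus2 → ℝ}
    (hf : MemLp f 2 torusMeasure) (hw : MemLp w 2 torusMeasure) :
    |∫ x, f x * w x ∂torusMeasure| ≤ lpNorm f 2 torusMeasure * lpNorm w 2 torusMeasure := by
  simpa only [real_inner_eq_re_inner, RCLike.inner_apply, conj_trivial, RCLike.re_to_real,
    mul_comm (w _)] using abs_integral_inner_le hf hw

/-- Pairing with a fixed `L²` function is continuous in `L²`. -/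
lemma tendsto_integral_mul {ι : Type*} {l : Filter ι} {F : ι → Torus2 → ℝ} {f w : Torus2 → ℝ}
    (hF : ∀ n, MemLp (F n) 2 torusMeasure) (hf : MemLp f 2 torusMeasure)
    (hw : MemLp w 2 torusMeasure)
    (h : Tendsto (fun n => lpNorm (F n - f) 2 torusMeasure) l (𝓝 0)) :
    Tendsto (fun n => ∫ x, F n x * w x ∂torusMeasure) l (𝓝 (∫ x, f x * w x ∂torusMeasure)) := by
  rw [tendsto_iff_norm_sub_tendsto_zero]
  refine squeeze_zero (fun _ => norm_nonneg _) (fun n => ?_)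
    (by simpa using h.mul_const (lpNorm w 2 torusMeasure))
  have h1 : Integrable (fun x => F n x * w x) torusMeasure := (hF n).integrable_mul hw
  have h2 : Integrable (fun x => f x * w x) torusMeasure := hf.integrable_mul hw
  rw [← integral_sub h1 h2]
  refine (le_of_eq ?_).trans (abs_integral_mul_le ((hF n).sub hf) hw)
  simp [sub_mul]

/-! ### Trigonometric polynomials and Fourier series -/

/-- The Fourier coefficients of a real function on the torus. -/
def realCoeff (f : Torus2 → ℝ) (k : Fin 2 → ℤ) : ℂ := mFourierCoeff (fun y => (f y : ℂ)) k

/-- The real part of the trigonometric polynomial `∑_{k ∈ s} aₖ e^{2πik·x}`. -/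
def trigSum (s : Finset (Fin 2 → ℤ)) (a : (Fin 2 → ℤ) → ℂ) (x : Torus2) : ℝ :=
  (∑ k ∈ s, a k * mFourier k x).re

lemma mFourier_apply_add (k : Fin 2 → ℤ) (x y : Torus2) :
    mFourier k (x + y) = mFourier k x * mFourier k y := by
  simp [mFourier, fourier_apply, AddCircle.toCircle_add, mul_mul_mul_comm]

lemma norm_mFourier_apply (k : Fin 2 → ℤ) (x : Torus2) : ‖mFourier k x‖ = 1 := by
  simp [mFourier, fourier_apply, Circle.norm_coe]

lemma mFourier_toTorus (k : Fin 2 → ℤ) (y : Fin 2 → ℝ) :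
    mFourier k (toTorus y) =
      Complex.exp (2 * Real.pi * Complex.I * (k 0 * y 0 + k 1 * y 1)) := by
  simp only [mFourier, toTorus, ContinuousMap.coe_mk, fourier_coe_apply, Fin.prod_univ_two,
    ← Complex.exp_add]
  congr 1
  push_cast
  ring

lemma mFourier_axisStep (k : Fin 2 → ℤ) (i : Fin 2) (s : ℝ) :
    mFourier k (axisStep i s) = Complex.exp (2 * Real.pi * Complex.I * k i * s) := by
  rw [← toTorus_smul_single, mFourier_toTorus]
  congr 1
  fin_cases i <;> simp <;> ring

lemma smoothTorus_trigSum (s : Finset (Fin 2 → ℤ)) (a : (Fin 2 → ℤ) → ℂ) :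
    SmoothTorus (trigSum s a) := by
  have : ContDiff ℝ ∞ fun y : Fin 2 → ℝ => (∑ k ∈ s, a k *
      Complex.exp (2 * Real.pi * Complex.I * (k 0 * y 0 + k 1 * y 1))).re := by
    refine Complex.reCLM.contDiff.comp (ContDiff.sum fun k _ => contDiff_const.mul ?_)
    have h (i : Fin 2) : ContDiff ℝ ∞ fun y : Fin 2 → ℝ => (y i : ℂ) :=
      Complex.ofRealCLM.contDiff.comp (contDiff_apply ℝ ℝ i)
    exact (contDiff_const.mul ((contDiff_const.mul (h 0)).add (contDiff_const.mul (h 1)))).cexp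
  simpa only [← mFourier_toTorus] using! this

lemma torusPartial_trigSum (s : Finset (Fin 2 → ℤ)) (a : (Fin 2 → ℤ) → ℂ) (i : Fin 2)
    (x : Torus2) :
    torusPartial i (trigSum s a) x
      = trigSum s (fun k => 2 * Real.pi * Complex.I * k i * a k) x := by
  refine torusPartial_eq_of_hasDerivAt ?_
  have h (k : Fin 2 → ℤ) : HasDerivAt (fun t : ℝ => a k * mFourier k (x + axisStep i t))
      (2 * Real.pi * Complex.I * k i * a k * mFourier k x) 0 := by
    simp only [mFourier_apply_add, mFourier_axisStep]
    have h1 : HasDerivAt (fun t : ℝ => 2 * Real.pi * Complex.I * k i * (t : ℂ))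
        (2 * Real.pi * Complex.I * k i * 1) 0 := (hasDerivAt_id 0).ofReal_comp.const_mul _
    convert! (h1.cexp.const_mul (mFourier k x)).const_mul (a k) using 1
    simp
    ring
  have h2 := HasDerivAt.fun_sum (u := s) (fun k _ => h k)
  exact Complex.reCLM.hasFDerivAt.comp_hasDerivAt _ h2

lemma integrable_mul_mFourier {f : Torus2 → ℝ} (hf : Integrable f torusMeasure)
    (k : Fin 2 → ℤ) : Integrable (fun x => (f x : ℂ) * mFourier k x) torusMeasure :=
  hf.ofReal.mul_bdd (c := 1) (mFourier k).continuous.aestronglyMeasurable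
    (.of_forall fun x => (norm_mFourier_apply k x).le)

lemma realCoeff_eq (f : Torus2 → ℝ) (k : Fin 2 → ℤ) :
    realCoeff f k = ∫ x, (f x : ℂ) * mFourier (-k) x ∂torusMeasure := by
  simp only [realCoeff, mFourierCoeff, smul_eq_mul, mul_comm (mFourier (-k) _)]
  rfl

lemma integral_mul_trigSum {f : Torus2 → ℝ} (hf : Integrable f torusMeasure)
    (s : Finset (Fin 2 → ℤ)) (a : (Fin 2 → ℤ) → ℂ) :
    ∫ x, f x * trigSum s a x ∂torusMeasure = (∑ k ∈ s, a k * realCoeff f (-k)).re := by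
  have h (k : Fin 2 → ℤ) : a k * realCoeff f (-k) =
      ∫ x, a k * ((f x : ℂ) * mFourier k x) ∂torusMeasure := by
    rw [realCoeff_eq, neg_neg, ← integral_const_mul]
  have hi (k : Fin 2 → ℤ) :
      Integrable (fun x => a k * ((f x : ℂ) * mFourier k x)) torusMeasure :=
    (integrable_mul_mFourier hf k).const_mul _
  simp only [h]
  rw [← integral_finsetSum _ (fun k _ => hi k)]
  have := Complex.reCLM.integral_comp_comm (integrable_finsetSum s fun k _ => hi k)
  simp only [Complex.reCLM_apply] at this
  rw [← this]
  refine integral_congr_ae (.of_forall fun x => ?_)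
  simp only [trigSum]
  rw [← Complex.re_ofReal_mul, Finset.mul_sum]
  congr 1
  exact Finset.sum_congr rfl fun k _ => by ring

/-- An integrable function that is orthogonal to all smooth functions vanishes: trigonometric
polynomials are uniformly dense in the continuous functions. -/
lemma ae_eq_zero_of_forall_smooth {w : Torus2 → ℝ} (hw : Integrable w torusMeasure)
    (h : ∀ φ, SmoothTorus φ → ∫ x, w x * φ x ∂torusMeasure = 0) : w =ᵐ[torusMeasure] 0 := by
  have hcoeff (k : Fin 2 → ℤ) : ∫ x, (w x : ℂ) * mFourier k x ∂torusMeasure = 0 := by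
    have h1 (c : ℂ) : (c * realCoeff w (-k)).re = 0 := by
      have := integral_mul_trigSum hw {k} (fun _ => c)
      rw [h _ (smoothTorus_trigSum _ _), Finset.sum_singleton] at this
      exact this.symm
    have h2 := h1 1
    have h3 := h1 Complex.I
    rw [← neg_neg k, ← realCoeff_eq]
    refine Complex.ext ?_ ?_
    · simpa using h2
    · simpa using h3
  have hwc : Integrable (fun x => (w x : ℂ)) torusMeasure := hw.ofReal
  have hint (F : C(Torus2, ℂ)) : Integrable (fun x => (w x : ℂ) * F x) torusMeasure :=
    hwc.mul_bdd F.continuous.aestronglyMeasurable (.of_forall F.norm_coe_le_norm)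
  let Λ : C(Torus2, ℂ) →L[ℂ] ℂ := LinearMap.mkContinuous
    { toFun := fun F => ∫ x, (w x : ℂ) * F x ∂torusMeasure
      map_add' := fun F G => by
        simp only [ContinuousMap.add_apply, mul_add]
        exact integral_add (hint F) (hint G)
      map_smul' := fun c F => by
        simp only [ContinuousMap.smul_apply, smul_eq_mul, mul_left_comm _ c,
          RingHom.id_apply]
        exact integral_const_mul _ _ }
    (∫ x, ‖(w x : ℂ)‖ ∂torusMeasure) (fun F => by
      refine (norm_integral_le_integral_norm _).trans ?_
      rw [← integral_mul_const]
      refine integral_mono (hint F).norm (hwc.norm.mul_const _) fun x => ?_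
      simp only [norm_mul]
      gcongr
      exact F.norm_coe_le_norm x)
  have hΛ (F : C(Torus2, ℂ)) : ∫ x, (w x : ℂ) * F x ∂torusMeasure = 0 := by
    have hle : (Submodule.span ℂ (Set.range (mFourier (d := Fin 2)))).topologicalClosure
        ≤ LinearMap.ker (Λ : C(Torus2, ℂ) →ₗ[ℂ] ℂ) := by
      refine Submodule.topologicalClosure_minimal _ ?_ Λ.isClosed_ker
      rw [Submodule.span_le]
      rintro _ ⟨k, rfl⟩
      exact hcoeff k
    rw [span_mFourier_closure_eq_top] at hle
    exact hle (Submodule.mem_top (x := F))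
  refine ae_eq_zero_of_forall_setIntegral_isClosed_eq_zero hw fun s hs => ?_
  have hlim : Tendsto (fun n => ∫ x, w x * (hs.apprSeq n x : ℝ) ∂torusMeasure) atTop
      (𝓝 (∫ x, w x * s.indicator 1 x ∂torusMeasure)) := by
    refine tendsto_integral_of_dominated_convergence (fun x => ‖w x‖) (fun n => ?_) hw.norm
      (fun n => .of_forall fun x => ?_) (.of_forall fun x => ?_)
    · exact hw.1.mul (NNReal.continuous_coe.comp (hs.apprSeq n).continuous).aestronglyMeasurable
    · rw [norm_mul]
      refine mul_le_of_le_one_right (norm_nonneg _) ?_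
      simpa using HasOuterApproxClosed.apprSeq_apply_le_one hs n x
    · refine Tendsto.const_mul _ ?_
      have h1 := tendsto_pi_nhds.1 (HasOuterApproxClosed.tendsto_apprSeq hs) x
      have h2 := (NNReal.continuous_coe.tendsto _).comp h1
      refine h2.congr' (.of_forall fun n => rfl) |>.trans (le_of_eq ?_)
      by_cases hx : x ∈ s <;> simp [hx]
  have hzero (n : ℕ) : ∫ x, w x * (hs.apprSeq n x : ℝ) ∂torusMeasure = 0 := by
    have := hΛ ⟨fun x => ((hs.apprSeq n x : ℝ) : ℂ), Complex.continuous_ofReal.comp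
      (NNReal.continuous_coe.comp (hs.apprSeq n).continuous)⟩
    simp only [ContinuousMap.coe_mk, ← Complex.ofReal_mul] at this
    rw [integral_complex_ofReal] at this
    exact_mod_cast this
  simp only [hzero] at hlim
  rw [← integral_indicator hs.measurableSet, tendsto_nhds_unique tendsto_const_nhds hlim]
  refine integral_congr_ae (.of_forall fun x => ?_)
  by_cases hx : x ∈ s <;> simp [hx]

lemma ae_eq_of_forall_smooth {f g : Torus2 → ℝ} (hf : Integrable f torusMeasure)
    (hg : Integrable g torusMeasure)
    (h : ∀ φ, SmoothTorus φ → ∫ x, f x * φ x ∂torusMeasure = ∫ x, g x * φ x ∂torusMeasure) :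
    f =ᵐ[torusMeasure] g := by
  have h1 := ae_eq_zero_of_forall_smooth (hf.sub hg) fun φ hφ => by
    simp only [Pi.sub_apply, sub_mul]
    rw [integral_sub (hφ.integrable_mul hf) (hφ.integrable_mul hg), h φ hφ, sub_self]
  filter_upwards [h1] with x hx
  simpa [sub_eq_zero] using hx

/-- If a Fourier series converges in `L²`, then the real parts of its partial sums converge to the
real part of its sum. -/
lemma lpNorm_trigSum_sub_tendsto {b : (Fin 2 → ℤ) → ℂ}
    {F : Lp ℂ 2 torusMeasure}
    (hF : HasSum (fun k => b k • (mFourierLp 2 k : Lp ℂ 2 torusMeasure)) F) :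
    Tendsto (fun s => lpNorm (trigSum s b - fun x => (F x).re) 2 torusMeasure) atTop (𝓝 0) := by
  have h1 := tendsto_iff_norm_sub_tendsto_zero.1 hF
  refine squeeze_zero (fun _ => lpNorm_nonneg) (fun s => ?_) h1
  set G : Lp ℂ 2 torusMeasure := ∑ k ∈ s, b k • (mFourierLp 2 k : Lp ℂ 2 torusMeasure) with hG
  have hGae : ∀ᵐ x ∂torusMeasure, G x = ∑ k ∈ s, b k * mFourier k x := by
    have h2 := Lp.coeFn_finsetSum s fun k => b k • (mFourierLp 2 k : Lp ℂ 2 torusMeasure)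
    have h3 : ∀ᵐ x ∂torusMeasure, ∀ k ∈ s, (b k • (mFourierLp 2 k : Lp ℂ 2 torusMeasure)) x
        = b k * mFourier k x := by
      refine (Filter.eventually_all_finset s).2 fun k _ => ?_
      filter_upwards [Lp.coeFn_smul (b k) (mFourierLp 2 k : Lp ℂ 2 torusMeasure),
        coeFn_mFourierLp (d := Fin 2) 2 k] with x h4 h5
      rw [h4, Pi.smul_apply, h5, smul_eq_mul]
    filter_upwards [h2, h3] with x h4 h5
    rw [hG, h4, Finset.sum_apply]
    exact Finset.sum_congr rfl h5
  rw [Lp.norm_def, ← toReal_eLpNorm ((smoothTorus_trigSum s b).continuous.aestronglyMeasurable.sub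
    (Complex.continuous_re.comp_aestronglyMeasurable (Lp.aestronglyMeasurable F)))]
  refine ENNReal.toReal_mono (Lp.eLpNorm_ne_top _) (eLpNorm_mono_ae ?_)
  filter_upwards [hGae, Lp.coeFn_sub G F] with x h4 h5
  rw [h5, Pi.sub_apply, Pi.sub_apply, h4, trigSum, ← Complex.sub_re]
  exact Complex.abs_re_le_norm _

/-- The Fourier series of a square integrable real function converges in `L²`. -/
lemma lpNorm_trigSum_realCoeff_sub_tendsto {f : Torus2 → ℝ} (hf : MemLp f 2 torusMeasure) :
    Tendsto (fun s => lpNorm (trigSum s (realCoeff f) - f) 2 torusMeasure) atTop (𝓝 0) := by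
  have hfc : MemLp (fun x => (f x : ℂ)) 2 torusMeasure := hf.ofReal
  have h1 := hasSum_mFourier_series_L2 (d := Fin 2) (hfc.toLp _)
  have h2 (k : Fin 2 → ℤ) : mFourierCoeff (hfc.toLp _) k = realCoeff f k := by
    refine integral_congr_ae ?_
    filter_upwards [hfc.coeFn_toLp] with x hx
    rw [hx]
  simp only [h2] at h1
  refine (lpNorm_trigSum_sub_tendsto h1).congr fun s => ?_
  have hae : (trigSum s (realCoeff f) - fun x => ((hfc.toLp _ : Lp ℂ 2 torusMeasure) x).re)
      =ᵐ[torusMeasure] trigSum s (realCoeff f) - f := by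
    filter_upwards [hfc.coeFn_toLp] with x hx
    rw [Pi.sub_apply, Pi.sub_apply, hx, Complex.ofReal_re]
  have hm := (smoothTorus_trigSum s (realCoeff f)).continuous.aestronglyMeasurable
    (μ := torusMeasure)
  rw [← toReal_eLpNorm (hm.sub hf.1), ← eLpNorm_congr_ae hae, toReal_eLpNorm]
  exact (hm.sub hf.1).congr hae.symm

/-! ### Weak gradients -/

namespace HasWeakGradient

variable {f : Torus2 → ℝ} {g g' : Torus2 → Vec2}

lemma integrable_apply (h : HasWeakGradient f g) (i : Fin 2) :
    Integrable (fun x => g x i) torusMeasure :=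
  (EuclideanSpace.proj (𝕜 := ℝ) i).integrable_comp h.2.1

lemma ae_unique (h : HasWeakGradient f g) (h' : HasWeakGradient f g') :
    g =ᵐ[torusMeasure] g' := by
  have h1 (i : Fin 2) : (fun x => g x i) =ᵐ[torusMeasure] fun x => g' x i :=
    ae_eq_of_forall_smooth (h.integrable_apply i) (h'.integrable_apply i) fun φ hφ =>
      neg_injective ((h.2.2 φ hφ i).symm.trans (h'.2.2 φ hφ i))
  filter_upwards [h1 0, h1 1] with x h2 h3
  ext i
  fin_cases i
  · exact h2
  · exact h3

lemma weakGradient_ae_eq (h : HasWeakGradient f g) : weakGradient f =ᵐ[torusMeasure] g := by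
  have hex : ∃ g, HasWeakGradient f g := ⟨g, h⟩
  rw [weakGradient, dif_pos hex]
  exact hex.choose_spec.ae_unique h

/-- The Fourier coefficients of a weak derivative. -/
lemma realCoeff_apply (h : HasWeakGradient f g) (i : Fin 2) (k : Fin 2 → ℤ) :
    realCoeff (fun x => g x i) k = 2 * Real.pi * Complex.I * k i * realCoeff f k := by
  have h1 (c : ℂ) : (c * (realCoeff (fun x => g x i) k
      - 2 * Real.pi * Complex.I * k i * realCoeff f k)).re = 0 := by
    have h2 := h.2.2 _ (smoothTorus_trigSum {-k} fun _ => c) i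
    simp only [torusPartial_trigSum] at h2
    rw [integral_mul_trigSum h.1, integral_mul_trigSum (h.integrable_apply i)] at h2
    simp only [Finset.sum_singleton, neg_neg, ← Complex.neg_re] at h2
    rw [mul_sub, Complex.sub_re, ← neg_eq_zero, neg_sub, sub_eq_add_neg, ← Complex.neg_re, ← h2,
      ← Complex.add_re, ← Complex.zero_re]
    congr 1
    simp
    ring
  rw [← sub_eq_zero]
  have h2 := h1 1
  have h3 := h1 Complex.I
  refine Complex.ext ?_ ?_
  · simpa using h2
  · rw [Complex.I_mul_re, neg_eq_zero] at h3
    exact h3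

end HasWeakGradient

/-! ### The `L⁴` norm and weak limits -/

section WeakLimits

variable {E : Type*} [NormedAddCommGroup E] {f g : Torus2 → E}

lemma lpNorm_four_pow (hf : AEStronglyMeasurable f torusMeasure) :
    lpNorm f 4 torusMeasure ^ 4 = ∫ x, ‖f x‖ ^ 4 ∂torusMeasure := by
  rw [lpNorm_eq_integral_norm_rpow_toReal (by simp) (by simp) hf]
  have h4 : (4 : ℝ≥0∞).toReal = ((4 : ℕ) : ℝ) := by simp
  rw [h4, Real.rpow_inv_natCast_pow (integral_nonneg fun x => by positivity) (by simp)]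
  simp only [Real.rpow_natCast]

lemma integrable_norm_pow_four_of_memLp (hf : MemLp f 4 torusMeasure) :
    Integrable (fun x => ‖f x‖ ^ 4) torusMeasure := by
  simpa using hf.integrable_norm_pow (p := 4) (by simp)

lemma memLp_two_of_four (hf : MemLp f 4 torusMeasure) : MemLp f 2 torusMeasure :=
  hf.mono_exponent (by norm_num)

lemma lpNorm_mono_exponent {p q : ℝ≥0∞} (hpq : p ≤ q) (hf : MemLp f q torusMeasure) :
    lpNorm f p torusMeasure ≤ lpNorm f q torusMeasure := by
  rw [← toReal_eLpNorm hf.1, ← toReal_eLpNorm hf.1]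
  exact ENNReal.toReal_mono hf.2.ne (eLpNorm_le_eLpNorm_of_exponent_le hpq hf.1)

lemma lpNorm_two_le_four (hf : MemLp f 4 torusMeasure) :
    lpNorm f 2 torusMeasure ≤ lpNorm f 4 torusMeasure :=
  lpNorm_mono_exponent (by norm_num) hf

lemma lpNorm_congr_torus {p : ℝ≥0∞} (h : f =ᵐ[torusMeasure] g) :
    lpNorm f p torusMeasure = lpNorm g p torusMeasure := by
  by_cases hf : AEStronglyMeasurable f torusMeasure
  · rw [← toReal_eLpNorm hf, ← toReal_eLpNorm (hf.congr h), eLpNorm_congr_ae h]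
  · rw [lpNorm_of_not_aestronglyMeasurable hf,
      lpNorm_of_not_aestronglyMeasurable fun hg => hf (hg.congr h.symm)]

lemma lpNorm_four_le_of_integral_le {A : ℝ} (hA : 0 ≤ A)
    (hf : AEStronglyMeasurable f torusMeasure) (h : ∫ x, ‖f x‖ ^ 4 ∂torusMeasure ≤ A ^ 4) :
    lpNorm f 4 torusMeasure ≤ A := by
  rw [← lpNorm_four_pow hf] at h
  exact le_of_pow_le_pow_left₀ (by norm_num) hA h

variable [InnerProductSpace ℝ E]

lemma integrable_inner_torus (hf : MemLp f 2 torusMeasure) (hg : MemLp g 2 torusMeasure) :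
    Integrable (fun x => inner ℝ (f x) (g x)) torusMeasure := by
  refine (MemLp.integrable_mul hf.norm hg.norm).mono' (hf.1.inner hg.1) (.of_forall fun x => ?_)
  exact norm_inner_le_norm _ _

/-- Weak convergence in `L²` along a filter. -/
def WeakTendsto {ι : Type*} (F : ι → Torus2 → E) (U : Filter ι) (f : Torus2 → E) : Prop :=
  ∀ w : Torus2 → E, MemLp w 2 torusMeasure →
    Tendsto (fun n => ∫ x, inner ℝ (F n x) (w x) ∂torusMeasure) U
      (𝓝 (∫ x, inner ℝ (f x) (w x) ∂torusMeasure))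

/-- Weak compactness of bounded sets of `L²`, along an ultrafilter. -/
lemma exists_weakTendsto [CompleteSpace E] {ι : Type*} (U : Ultrafilter ι)
    {F : ι → Torus2 → E} (hF : ∀ n, MemLp (F n) 2 torusMeasure) {K : ℝ}
    (hK : ∀ n, lpNorm (F n) 2 torusMeasure ≤ K) :
    ∃ f, MemLp f 2 torusMeasure ∧ WeakTendsto F U f := by
  let D : ι → WeakDual ℝ (Lp E 2 torusMeasure) := fun n =>
    StrongDual.toWeakDual (InnerProductSpace.toDual ℝ (Lp E 2 torusMeasure) ((hF n).toLp))
  have hD : ((U.map D : Ultrafilter (WeakDual ℝ (Lp E 2 torusMeasure))) :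
      Filter (WeakDual ℝ (Lp E 2 torusMeasure)))
      ≤ 𝓟 (WeakDual.toStrongDual ⁻¹' Metric.closedBall 0 K) := by
    rw [Ultrafilter.coe_map, Filter.le_principal_iff, Filter.mem_map]
    refine Filter.univ_mem' fun n => ?_
    have : ‖(hF n).toLp‖ ≤ K := by
      rw [Lp.norm_toLp, toReal_eLpNorm (hF n).1]
      exact hK n
    change dist (InnerProductSpace.toDual ℝ (Lp E 2 torusMeasure) ((hF n).toLp)) 0 ≤ K
    rw [dist_zero_right, LinearIsometryEquiv.norm_map]
    exact this
  obtain ⟨y, -, hy⟩ := (WeakDual.isCompact_closedBall (0 : StrongDual ℝ (Lp E 2 torusMeasure))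
    K).ultrafilter_le_nhds (U.map D) hD
  obtain ⟨z, hz⟩ := (InnerProductSpace.toDual ℝ (Lp E 2 torusMeasure)).surjective
    (WeakDual.toStrongDual y)
  refine ⟨z, Lp.memLp z, fun w hw => ?_⟩
  have h1 : Tendsto (fun n => D n hw.toLp) U (𝓝 (y hw.toLp)) :=
    ((WeakDual.eval_continuous hw.toLp).tendsto y).comp hy
  have h2 : y hw.toLp = inner ℝ z hw.toLp := by
    rw [← InnerProductSpace.toDual_apply_apply (𝕜 := ℝ), hz]
    rfl
  have h3 (n : ι) : D n hw.toLp = ∫ x, inner ℝ (F n x) (w x) ∂torusMeasure := by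
    have : D n hw.toLp = inner ℝ (hF n).toLp hw.toLp := rfl
    rw [this, L2.inner_def]
    refine integral_congr_ae ?_
    filter_upwards [(hF n).coeFn_toLp, hw.coeFn_toLp] with x h4 h5
    rw [h4, h5]
  have h4 : y hw.toLp = ∫ x, inner ℝ (z x) (w x) ∂torusMeasure := by
    rw [h2, L2.inner_def]
    refine integral_congr_ae ?_
    filter_upwards [hw.coeFn_toLp] with x h5
    rw [h5]
  simpa only [h3, h4] using h1

/-- The `L⁴` norm is weakly lower semicontinuous. The sequence is tested with the truncations
`min(|f|, K)² f` of `|f|² f`; Young's inequality bounds the pairing. -/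
lemma WeakTendsto.lpNorm_four_le {ι : Type*} {U : Filter ι} [U.NeBot] {F : ι → Torus2 → E}
    (h : WeakTendsto F U f) (hf : MemLp f 2 torusMeasure) {A : ℝ} (hA : 0 ≤ A)
    (hF : ∀ n, MemLp (F n) 4 torusMeasure) (hFA : ∀ n, lpNorm (F n) 4 torusMeasure ≤ A) :
    MemLp f 4 torusMeasure ∧ lpNorm f 4 torusMeasure ≤ A := by
  have hfm := hf.1
  have hsq : Integrable (fun x => ‖f x‖ ^ 2) torusMeasure := by
    simpa using hf.integrable_norm_pow (p := 2) (by simp)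
  have hmeas (K : ℝ) : AEStronglyMeasurable (fun x => min ‖f x‖ K ^ 2) torusMeasure :=
    ((hfm.norm.inf aestronglyMeasurable_const).pow 2)
  have hbd (K : ℝ) (hK : 0 ≤ K) (x : Torus2) : ‖min ‖f x‖ K ^ 2‖ ≤ K ^ 2 := by
    rw [norm_pow, Real.norm_of_nonneg (le_min (norm_nonneg _) hK)]
    exact pow_le_pow_left₀ (le_min (norm_nonneg _) hK) (min_le_right _ _) 2
  have hI (K : ℝ) (hK : 0 ≤ K) :
      Integrable (fun x => min ‖f x‖ K ^ 2 * ‖f x‖ ^ 2) torusMeasure :=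
    hsq.bdd_mul (hmeas K) (.of_forall (hbd K hK))
  have key (K : ℝ) (hK : 0 ≤ K) :
      ∫ x, min ‖f x‖ K ^ 2 * ‖f x‖ ^ 2 ∂torusMeasure ≤ A ^ 4 := by
    have hw : MemLp (fun x => min ‖f x‖ K ^ 2 • f x) 2 torusMeasure :=
      hf.of_le_mul (c := K ^ 2) ((hmeas K).smul hfm) (.of_forall fun x => by
        rw [norm_smul]
        gcongr
        exact hbd K hK x)
    have h1 := h _ hw
    have h2 (n : ι) : ∫ x, inner ℝ (F n x) (min ‖f x‖ K ^ 2 • f x) ∂torusMeasure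
        ≤ A ^ 4 / 4 + 3 / 4 * ∫ x, min ‖f x‖ K ^ 2 * ‖f x‖ ^ 2 ∂torusMeasure := by
      have h3 : ∫ x, ‖F n x‖ ^ 4 ∂torusMeasure ≤ A ^ 4 := by
        rw [← lpNorm_four_pow (hF n).1]
        exact pow_le_pow_left₀ lpNorm_nonneg (hFA n) 4
      have hi := (integrable_norm_pow_four_of_memLp (hF n)).div_const 4
      calc _ ≤ ∫ x, (‖F n x‖ ^ 4 / 4 + 3 / 4 * (min ‖f x‖ K ^ 2 * ‖f x‖ ^ 2)) ∂torusMeasure := by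
            refine integral_mono (integrable_inner_torus (memLp_two_of_four (hF n)) hw)
              (hi.add ((hI K hK).const_mul _)) fun x => ?_
            have hm : 0 ≤ min ‖f x‖ K := le_min (norm_nonneg _) hK
            have hmb : min ‖f x‖ K ≤ ‖f x‖ := min_le_left _ _
            have h6 : inner ℝ (F n x) (min ‖f x‖ K ^ 2 • f x)
                ≤ ‖F n x‖ * (min ‖f x‖ K ^ 2 * ‖f x‖) := by
              refine (real_inner_le_norm _ _).trans (le_of_eq ?_)
              rw [norm_smul, Real.norm_of_nonneg (by positivity)]
            have h7 : min ‖f x‖ K ^ 2 ≤ ‖f x‖ ^ 2 := pow_le_pow_left₀ hm hmb 2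
            simp only
            nlinarith [sq_nonneg (min ‖f x‖ K * (‖F n x‖ - ‖f x‖)),
              sq_nonneg (‖F n x‖ ^ 2 - min ‖f x‖ K ^ 2),
              mul_le_mul_of_nonneg_left h7 (sq_nonneg (min ‖f x‖ K))]
        _ = (∫ x, ‖F n x‖ ^ 4 ∂torusMeasure) / 4
              + 3 / 4 * ∫ x, min ‖f x‖ K ^ 2 * ‖f x‖ ^ 2 ∂torusMeasure := by
            rw [integral_add hi ((hI K hK).const_mul _), integral_div, integral_const_mul]
        _ ≤ _ := by gcongr
    have h4 := le_of_tendsto h1 (.of_forall h2)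
    have h5 : ∫ x, inner ℝ (f x) (min ‖f x‖ K ^ 2 • f x) ∂torusMeasure
        = ∫ x, min ‖f x‖ K ^ 2 * ‖f x‖ ^ 2 ∂torusMeasure := by
      simp only [inner_smul_right, real_inner_self_eq_norm_sq]
    linarith
  have hlint : ∫⁻ x, ‖f x‖ₑ ^ 4 ∂torusMeasure ≤ ENNReal.ofReal (A ^ 4) := by
    have hle (n : ℕ) : ∫⁻ x, ENNReal.ofReal (min ‖f x‖ n ^ 2 * ‖f x‖ ^ 2) ∂torusMeasure
        ≤ ENNReal.ofReal (A ^ 4) := by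
      rw [← ofReal_integral_eq_lintegral_ofReal (hI n (by positivity))
        (.of_forall fun x => by positivity)]
      exact ENNReal.ofReal_le_ofReal (key n (by positivity))
    have heq (x : Torus2) : liminf (fun n : ℕ => ENNReal.ofReal (min ‖f x‖ n ^ 2 * ‖f x‖ ^ 2)) atTop
        = ‖f x‖ₑ ^ 4 := by
      refine Tendsto.liminf_eq (tendsto_const_nhds.congr' ?_)
      filter_upwards [eventually_ge_atTop ⌈‖f x‖⌉₊] with n hn
      rw [min_eq_left (Nat.ceil_le.1 hn), ← pow_add, ENNReal.ofReal_pow (norm_nonneg _),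
        ofReal_norm]
    simp only [← heq]
    refine (lintegral_liminf_le' fun n : ℕ =>
      (hI n (by positivity)).1.aemeasurable.ennreal_ofReal).trans
      (liminf_le_of_frequently_le' (.of_forall hle))
  have hnorm : eLpNorm f 4 torusMeasure ≤ ENNReal.ofReal A := by
    rw [eLpNorm_eq_lintegral_rpow_enorm_toReal (by simp) (by simp)]
    have h4 : (4 : ℝ≥0∞).toReal = ((4 : ℕ) : ℝ) := by simp
    simp only [h4, ENNReal.rpow_natCast, one_div]
    refine (ENNReal.rpow_le_rpow hlint (by positivity)).trans (le_of_eq ?_)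
    rw [ENNReal.ofReal_pow hA, ← ENNReal.rpow_natCast, ← ENNReal.rpow_mul]
    simp
  refine ⟨⟨hfm, hnorm.trans_lt ENNReal.ofReal_lt_top⟩, ?_⟩
  rw [← toReal_eLpNorm hfm]
  exact ENNReal.toReal_le_of_le_ofReal hA hnorm

end WeakLimits

/-! ### Calculus of weak gradients -/

/-- The classical gradient of a function on the torus. -/
def torusGrad (φ : Torus2 → ℝ) (x : Torus2) : Vec2 := WithLp.toLp 2 fun i => torusPartial i φ x

lemma SmoothTorus.continuous_torusGrad {φ : Torus2 → ℝ} (hφ : SmoothTorus φ) :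
    Continuous (torusGrad φ) :=
  (PiLp.continuous_toLp 2 _).comp (continuous_pi fun i => (hφ.torusPartial i).continuous)

lemma norm_torusGrad_le {φ : Torus2 → ℝ} {L : ℝ} {x : Torus2}
    (hL : ∀ i, |torusPartial i φ x| ≤ L) : ‖torusGrad φ x‖ ≤ 2 * L := by
  have h0 : 0 ≤ L := (abs_nonneg _).trans (hL 0)
  rw [EuclideanSpace.norm_eq, Fin.sum_univ_two]
  refine Real.sqrt_le_iff.2 ⟨by positivity, ?_⟩
  have h1 := pow_le_pow_left₀ (abs_nonneg _) (hL 0) 2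
  have h2 := pow_le_pow_left₀ (abs_nonneg _) (hL 1) 2
  simp only [torusGrad, Real.norm_eq_abs]
  nlinarith

lemma memLp_apply {g : Torus2 → Vec2} {p : ℝ≥0∞} (hg : MemLp g p torusMeasure) (i : Fin 2) :
    MemLp (fun x => g x i) p torusMeasure :=
  hg.of_le ((EuclideanSpace.proj (𝕜 := ℝ) i).continuous.comp_aestronglyMeasurable hg.1)
    (.of_forall fun x => PiLp.norm_apply_le (g x) i)

namespace HasWeakGradient

variable {f f' : Torus2 → ℝ} {g g' : Torus2 → Vec2}

lemma zero : HasWeakGradient (fun _ => 0) (fun _ => 0) :=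
  ⟨integrable_zero _ _ _, integrable_zero _ _ _, fun φ _ i => by simp⟩

lemma add (h : HasWeakGradient f g) (h' : HasWeakGradient f' g') :
    HasWeakGradient (fun x => f x + f' x) (fun x => g x + g' x) := by
  refine ⟨h.1.add h'.1, h.2.1.add h'.2.1, fun φ hφ i => ?_⟩
  simp only [add_mul, PiLp.add_apply]
  rw [integral_add ((hφ.torusPartial i).integrable_mul h.1)
      ((hφ.torusPartial i).integrable_mul h'.1),
    integral_add (hφ.integrable_mul (h.integrable_apply i))
      (hφ.integrable_mul (h'.integrable_apply i)), h.2.2 φ hφ i, h'.2.2 φ hφ i]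
  ring

lemma const_mul (c : ℝ) (h : HasWeakGradient f g) :
    HasWeakGradient (fun x => c * f x) (fun x => c • g x) := by
  refine ⟨h.1.const_mul c, h.2.1.smul c, fun φ hφ i => ?_⟩
  simp only [mul_assoc, PiLp.smul_apply, smul_eq_mul]
  rw [integral_const_mul, integral_const_mul, h.2.2 φ hφ i]
  ring

lemma sub (h : HasWeakGradient f g) (h' : HasWeakGradient f' g') :
    HasWeakGradient (fun x => f x - f' x) (fun x => g x - g' x) := by
  simpa [sub_eq_add_neg] using h.add (h'.const_mul (-1))

lemma sum {ι : Type*} (s : Finset ι) {F : ι → Torus2 → ℝ} {G : ι → Torus2 → Vec2}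
    (h : ∀ k ∈ s, HasWeakGradient (F k) (G k)) :
    HasWeakGradient (fun x => ∑ k ∈ s, F k x) (fun x => ∑ k ∈ s, G k x) := by
  classical
  induction s using Finset.induction_on with
  | empty => simpa using zero
  | insert k s hk ih =>
    simp only [Finset.sum_insert hk]
    exact (h k (Finset.mem_insert_self k s)).add
      (ih fun j hj => h j (Finset.mem_insert_of_mem hj))

lemma comp_add (h : HasWeakGradient f g) (z : Torus2) :
    HasWeakGradient (fun x => f (x + z)) (fun x => g (x + z)) := by
  refine ⟨(measurePreserving_add_torus z).integrable_comp_of_integrable h.1,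
    (measurePreserving_add_torus z).integrable_comp_of_integrable h.2.1, fun φ hφ i => ?_⟩
  rw [← integral_add_torus _ (-z), ← integral_add_torus (fun x => g (x + z) i * φ x) (-z)]
  simp only [neg_add_cancel_right]
  rw [← h.2.2 _ (hφ.comp_add (-z)) i]
  simp only [hφ.torusPartial_comp_add]

/-- Product rule with a smooth factor. -/
lemma smooth_mul (h : HasWeakGradient f g) {a : Torus2 → ℝ} (ha : SmoothTorus a) :
    HasWeakGradient (fun x => a x * f x) (fun x => a x • g x + f x • torusGrad a x) := by
  obtain ⟨C, -, hC⟩ := ha.exists_bound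
  have hgi : Integrable (fun x => a x • g x) torusMeasure :=
    h.2.1.bdd_smul C ha.continuous.aestronglyMeasurable (.of_forall hC)
  have hfi : Integrable (fun x => f x • torusGrad a x) torusMeasure := by
    obtain ⟨C, hC⟩ := isCompact_univ.exists_bound_of_continuousOn
      ha.continuous_torusGrad.continuousOn
    exact h.1.smul_bdd C ha.continuous_torusGrad.aestronglyMeasurable
      (.of_forall fun x => hC x trivial)
  refine ⟨?_, hgi.add hfi, fun φ hφ i => ?_⟩
  · simpa only [mul_comm] using ha.integrable_mul h.1
  have h1 := h.2.2 _ (ha.mul hφ) i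
  simp only [ha.torusPartial_mul hφ] at h1
  have h2 : Integrable (fun x => f x * (torusPartial i a x * φ x)) torusMeasure :=
    ((ha.torusPartial i).mul hφ).integrable_mul h.1
  have h3 : Integrable (fun x => f x * (a x * torusPartial i φ x)) torusMeasure :=
    (ha.mul (hφ.torusPartial i)).integrable_mul h.1
  have h4 : Integrable (fun x => g x i * (a x * φ x)) torusMeasure :=
    (ha.mul hφ).integrable_mul (h.integrable_apply i)
  simp only [mul_add] at h1
  rw [integral_add h2 h3] at h1
  have h5 : ∫ x, (a x • g x + f x • torusGrad a x) i * φ x ∂torusMeasure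
      = ∫ x, g x i * (a x * φ x) ∂torusMeasure
        + ∫ x, f x * (torusPartial i a x * φ x) ∂torusMeasure := by
    rw [← integral_add h4 h2]
    refine integral_congr_ae (.of_forall fun x => ?_)
    simp [torusGrad]
    ring
  have h6 : ∫ x, a x * f x * torusPartial i φ x ∂torusMeasure
      = ∫ x, f x * (a x * torusPartial i φ x) ∂torusMeasure :=
    integral_congr_ae (.of_forall fun x => by ring)
  rw [h5, h6]
  linarith

end HasWeakGradient

lemma WeakTendsto.integral_mul {ι : Type*} {F : ι → Torus2 → ℝ} {U : Filter ι}
    {f : Torus2 → ℝ} (h : WeakTendsto F U f) {w : Torus2 → ℝ} (hw : MemLp w 2 torusMeasure) :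
    Tendsto (fun n => ∫ x, F n x * w x ∂torusMeasure) U
      (𝓝 (∫ x, f x * w x ∂torusMeasure)) := by
  simpa only [real_inner_eq_re_inner, RCLike.inner_apply, conj_trivial, RCLike.re_to_real,
    mul_comm (w _)] using h w hw

lemma WeakTendsto.apply {ι : Type*} {G : ι → Torus2 → Vec2} {U : Filter ι}
    {g : Torus2 → Vec2} (h : WeakTendsto G U g) (i : Fin 2) :
    WeakTendsto (fun n x => G n x i) U (fun x => g x i) := by
  intro w hw
  have h1 := h (fun x => w x • EuclideanSpace.single i 1)
    (hw.of_le (hw.1.smul_const _) (.of_forall fun x => by simp [norm_smul]))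
  simpa [inner_smul_right, EuclideanSpace.inner_single_right, real_inner_eq_re_inner] using h1

/-- Weak gradients are stable under weak limits. -/
lemma WeakTendsto.hasWeakGradient {ι : Type*} {U : Filter ι} [U.NeBot] {F : ι → Torus2 → ℝ}
    {G : ι → Torus2 → Vec2} {f : Torus2 → ℝ} {g : Torus2 → Vec2}
    (hF : WeakTendsto F U f) (hG : WeakTendsto G U g) (hf : MemLp f 2 torusMeasure)
    (hg : MemLp g 2 torusMeasure) (h : ∀ n, HasWeakGradient (F n) (G n)) :
    HasWeakGradient f g := by
  refine ⟨hf.integrable (by norm_num), hg.integrable (by norm_num), fun φ hφ i => ?_⟩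
  have h1 := hF.integral_mul ((hφ.torusPartial i).memLp 2)
  have h2 := ((hG.apply i).integral_mul (hφ.memLp 2)).neg
  refine tendsto_nhds_unique h1 (h2.congr fun n => ?_)
  rw [(h n).2.2 φ hφ i]

/-! ### Increments of Sobolev functions -/

lemma lpNorm_comp_add {E : Type*} [NormedAddCommGroup E] {f : Torus2 → E} {p : ℝ≥0∞}
    (hf : MemLp f p torusMeasure) (z : Torus2) :
    lpNorm (fun x => f (x + z)) p torusMeasure = lpNorm f p torusMeasure := by
  have h := measurePreserving_add_torus z
  rw [← toReal_eLpNorm hf.1, ← eLpNorm_comp_measurePreserving hf.1 h, toReal_eLpNorm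
    (hf.1.comp_measurePreserving h)]
  rfl

lemma memLp_comp_add {E : Type*} [NormedAddCommGroup E] {f : Torus2 → E} {p : ℝ≥0∞}
    (hf : MemLp f p torusMeasure) (z : Torus2) :
    MemLp (fun x => f (x + z)) p torusMeasure :=
  hf.comp_measurePreserving (measurePreserving_add_torus z)

lemma lpNorm_sum_le_torus {E ι : Type*} [NormedAddCommGroup E] (s : Finset ι)
    {F : ι → Torus2 → E} (hF : ∀ k ∈ s, MemLp (F k) 4 torusMeasure) :
    lpNorm (fun x => ∑ k ∈ s, F k x) 4 torusMeasure ≤ ∑ k ∈ s, lpNorm (F k) 4 torusMeasure := by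
  have h := lpNorm_sum_le hF (by norm_num)
  refine (le_of_eq ?_).trans h
  congr 1
  ext x
  simp

lemma lpNorm_le_of_norm_le {E E' : Type*} [NormedAddCommGroup E] [NormedAddCommGroup E']
    {f : Torus2 → E} {g : Torus2 → E'} {c : ℝ} {p : ℝ≥0∞} (hc : 0 ≤ c)
    (hf : AEStronglyMeasurable f torusMeasure)
    (hg : MemLp g p torusMeasure) (h : ∀ x, ‖f x‖ ≤ c * ‖g x‖) :
    lpNorm f p torusMeasure ≤ c * lpNorm g p torusMeasure := by
  rw [← toReal_eLpNorm hf, ← toReal_eLpNorm hg.1, ← ENNReal.toReal_ofReal hc,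
    ← ENNReal.toReal_mul]
  exact ENNReal.toReal_mono (ENNReal.mul_ne_top ENNReal.ofReal_ne_top hg.2.ne)
    (eLpNorm_le_mul_eLpNorm_of_ae_le_mul (.of_forall h) p)

lemma HasWeakGradient.integral_comp_add_mul {f : Torus2 → ℝ} {g : Torus2 → Vec2}
    (h : HasWeakGradient f g) {φ : Torus2 → ℝ} (hφ : SmoothTorus φ) (i : Fin 2) (z : Torus2) :
    ∫ x, g (x + z) i * φ x ∂torusMeasure
      = -∫ x, f x * torusPartial i φ (x + -z) ∂torusMeasure := by
  have h1 := (h.comp_add z).2.2 φ hφ i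
  rw [← integral_add_torus _ (-z)] at h1
  simp only [neg_add_cancel_right] at h1
  rw [h1, neg_neg]

/-- The increments of `f` over `t eᵢ` are bounded in `L⁴` by `|t| |∇f|₄`: they are the weak limit
of the Riemann sums of the translates of `∂ᵢf`. -/
lemma HasWeakGradient.lpNorm_increment_le {f : Torus2 → ℝ} {g : Torus2 → Vec2}
    (h : HasWeakGradient f g) (hf : MemLp f 4 torusMeasure) (hg : MemLp g 4 torusMeasure)
    (i : Fin 2) (t : ℝ) :
    lpNorm (fun x => f (x + axisStep i t) - f x) 4 torusMeasure
      ≤ |t| * lpNorm g 4 torusMeasure := by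
  let r : ℕ → ℝ := fun n => t / (n + 1)
  let G : ℕ → Torus2 → ℝ := fun n x =>
    ∑ k ∈ Finset.range (n + 1), r n * g (x + axisStep i (k * r n)) i
  have hr (n : ℕ) : (n + 1) * r n = t := by simp only [r]; field_simp
  have hGk (n k : ℕ) : MemLp (fun x => r n * g (x + axisStep i (k * r n)) i) 4 torusMeasure :=
    (memLp_apply (memLp_comp_add hg _) i).const_mul _
  have hGm (n : ℕ) : MemLp (G n) 4 torusMeasure := memLp_finsetSum _ fun k _ => hGk n k
  have hGn (n : ℕ) : lpNorm (G n) 4 torusMeasure ≤ |t| * lpNorm g 4 torusMeasure := by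
    refine (lpNorm_sum_le_torus _ fun k _ => hGk n k).trans ?_
    have h1 (k : ℕ) : lpNorm (fun x => r n * g (x + axisStep i (k * r n)) i) 4 torusMeasure
        ≤ |r n| * lpNorm g 4 torusMeasure := by
      rw [← lpNorm_comp_add hg (axisStep i (k * r n))]
      refine lpNorm_le_of_norm_le (abs_nonneg _) (hGk n k).1 (memLp_comp_add hg _) fun x => ?_
      rw [norm_mul]
      exact mul_le_mul_of_nonneg_left (PiLp.norm_apply_le _ i) (abs_nonneg _)
    refine (Finset.sum_le_sum fun k _ => h1 k).trans (le_of_eq ?_)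
    rw [Finset.sum_const, Finset.card_range, nsmul_eq_mul, ← mul_assoc, ← hr n, abs_mul]
    congr 2
    rw [abs_of_nonneg (by positivity)]
    push_cast
    rfl
  have hA : 0 ≤ |t| * lpNorm g 4 torusMeasure := mul_nonneg (abs_nonneg _) lpNorm_nonneg
  obtain ⟨w, hw2, hw⟩ := exists_weakTendsto (Filter.hyperfilter ℕ)
    (fun n => memLp_two_of_four (hGm n)) (fun n => (lpNorm_two_le_four (hGm n)).trans (hGn n))
  obtain ⟨hw4, hwA⟩ := hw.lpNorm_four_le hw2 hA hGm hGn
  have hfi : MemLp (fun x => f (x + axisStep i t) - f x) 4 torusMeasure :=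
    (memLp_comp_add hf _).sub hf
  rw [← lpNorm_congr_torus (f := w)]
  · exact hwA
  refine ae_eq_of_forall_smooth (hw2.integrable (by norm_num)) (hfi.integrable (by norm_num))
    fun φ hφ => ?_
  refine tendsto_nhds_unique (hw.integral_mul (hφ.memLp 2)) ?_
  refine Tendsto.mono_left ?_ (Nat.hyperfilter_le_atTop)
  obtain ⟨C, hC0, hC⟩ := hφ.exists_taylor_bound i
  -- the difference of the two pairings is the pairing of `f` with a Riemann sum error
  have herr (n : ℕ) : ‖∫ x, G n x * φ x ∂torusMeasure
      - ∫ x, (f (x + axisStep i t) - f x) * φ x ∂torusMeasure‖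
      ≤ (C * |t| * ∫ x, |f x| ∂torusMeasure) * |r n| := by
    have h1 : ∫ x, G n x * φ x ∂torusMeasure = ∑ k ∈ Finset.range (n + 1),
        r n * -∫ x, f x * torusPartial i φ (x + -axisStep i (k * r n)) ∂torusMeasure := by
      simp only [← h.integral_comp_add_mul hφ, ← integral_const_mul]
      rw [← integral_finsetSum]
      · simp only [G, Finset.sum_mul, mul_assoc]
      · intro k _
        simpa only [mul_assoc] using
          hφ.integrable_mul ((hGk n k).integrable (by norm_num))
    have h2 : ∫ x, (f (x + axisStep i t) - f x) * φ x ∂torusMeasure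
        = ∑ k ∈ Finset.range (n + 1),
          (∫ x, f x * φ (x + -axisStep i ((k + 1 : ℕ) * r n)) ∂torusMeasure
            - ∫ x, f x * φ (x + -axisStep i (k * r n)) ∂torusMeasure) := by
      rw [Finset.sum_range_sub fun k : ℕ =>
        ∫ x, f x * φ (x + -axisStep i (k * r n)) ∂torusMeasure]
      simp only [sub_mul]
      rw [integral_sub (hφ.integrable_mul ((memLp_comp_add hf _).integrable (by norm_num)))
        (hφ.integrable_mul h.1), ← integral_add_torus _ (-axisStep i t)]
      simp [hr, axisStep_zero]
    rw [h1, h2, ← Finset.sum_sub_distrib]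
    refine (norm_sum_le _ _).trans ?_
    have h3 (k : ℕ) : ‖r n * -∫ x, f x * torusPartial i φ (x + -axisStep i (k * r n)) ∂torusMeasure
        - (∫ x, f x * φ (x + -axisStep i ((k + 1 : ℕ) * r n)) ∂torusMeasure
            - ∫ x, f x * φ (x + -axisStep i (k * r n)) ∂torusMeasure)‖
        ≤ C * r n ^ 2 * ∫ x, |f x| ∂torusMeasure := by
      rw [mul_neg, ← integral_const_mul, ← integral_neg, ← integral_sub
        ((hφ.comp_add _).integrable_mul h.1) ((hφ.comp_add _).integrable_mul h.1),
        ← integral_sub, ← integral_const_mul]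
      · refine (norm_integral_le_integral_norm _).trans ?_
        refine integral_mono_of_nonneg (.of_forall fun x => norm_nonneg _)
          (h.1.norm.const_mul _) (.of_forall fun x => ?_)
        have h4 := hC (x + -axisStep i (k * r n)) (-r n)
        rw [axisStep_neg, add_assoc, ← neg_add, ← axisStep_add] at h4
        have h5 : (k * r n + r n) = ((k + 1 : ℕ) : ℝ) * r n := by push_cast; ring
        rw [h5, neg_sq] at h4
        simp only
        rw [Real.norm_eq_abs, ← abs_neg]
        calc _ = |f x| * |φ (x + -axisStep i ((k + 1 : ℕ) * r n)) - φ (x + -axisStep i (k * r n))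
              - -r n * torusPartial i φ (x + -axisStep i (k * r n))| := by
              rw [← abs_mul]
              congr 1
              ring
          _ ≤ |f x| * (C * r n ^ 2) := mul_le_mul_of_nonneg_left h4 (abs_nonneg _)
          _ = _ := mul_comm _ _
      · exact (((hφ.torusPartial i).comp_add _).integrable_mul h.1).const_mul _ |>.neg
      · exact ((hφ.comp_add _).integrable_mul h.1).sub ((hφ.comp_add _).integrable_mul h.1)
    refine (Finset.sum_le_sum fun k _ => h3 k).trans (le_of_eq ?_)
    rw [Finset.sum_const, Finset.card_range, nsmul_eq_mul, ← hr n, abs_mul, ← sq_abs (r n),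
      abs_of_nonneg (by positivity : (0 : ℝ) ≤ n + 1)]
    push_cast
    ring
  rw [tendsto_iff_norm_sub_tendsto_zero]
  refine squeeze_zero (fun _ => norm_nonneg _) herr ?_
  have h6 : Tendsto r atTop (𝓝 0) :=
    tendsto_const_nhds.div_atTop (tendsto_natCast_atTop_atTop.atTop_add tendsto_const_nhds)
  simpa using h6.abs.const_mul (C * |t| * ∫ x, |f x| ∂torusMeasure)

/-! ### A random walk approximation of the transport operator -/

section Walk

/-- The sign `±1` attached to a Boolean. -/
def walkSign (b : Bool) : ℝ := if b then 1 else -1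

/-- The rate `(c ± vᵢ)/2` of the jump against `± eᵢ`. -/
def walkWeight (c : ℝ) (v : Fin 2 → Torus2 → ℝ) (d : Fin 2 × Bool) (x : Torus2) : ℝ :=
  c / 2 + walkSign d.2 / 2 * v d.1 x

/-- The displacement `± h eᵢ`. -/
def walkStep (h : ℝ) (d : Fin 2 × Bool) : Torus2 := axisStep d.1 (walkSign d.2 * h)

/-- The transition operator `∑_d a_d f(· - z_d)` of the walk with rates `a_d` and jumps `-z_d`.
The operator `(2c - walkOp)/h` is a finite difference approximation of `v · ∇`. -/
def walkOp {E : Type*} [AddCommGroup E] [Module ℝ E] (c h : ℝ) (v : Fin 2 → Torus2 → ℝ)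
    (f : Torus2 → E) (x : Torus2) : E :=
  ∑ d, walkWeight c v d x • f (x + -walkStep h d)

lemma abs_walkSign (b : Bool) : |walkSign b| = 1 := by cases b <;> simp [walkSign]

lemma sum_walkWeight (c : ℝ) (v : Fin 2 → Torus2 → ℝ) (x : Torus2) :
    ∑ d, walkWeight c v d x = 2 * c := by
  simp [Fintype.sum_prod_type, walkWeight, walkSign]
  ring

/-- The `L⁴` contraction of an averaging operator, by Jensen's inequality. -/
lemma norm_sum_smul_pow_four_le {ι E : Type*} [NormedAddCommGroup E] [NormedSpace ℝ E]
    (s : Finset ι) {a : ι → ℝ} {A : ℝ} (ha : ∀ d ∈ s, 0 ≤ a d) (hA : 0 < A)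
    (hsum : ∑ d ∈ s, a d = A) (f : ι → E) :
    ‖∑ d ∈ s, a d • f d‖ ^ 4 ≤ A ^ 3 * ∑ d ∈ s, a d * ‖f d‖ ^ 4 := by
  have h1 : ‖∑ d ∈ s, a d • f d‖ ≤ A * ∑ d ∈ s, a d / A * ‖f d‖ := by
    refine (norm_sum_le _ _).trans (le_of_eq ?_)
    rw [Finset.mul_sum]
    refine Finset.sum_congr rfl fun d hd => ?_
    rw [norm_smul, Real.norm_of_nonneg (ha d hd)]
    field_simp
  have h2 := Real.pow_arith_mean_le_arith_mean_pow s (fun d => a d / A) (fun d => ‖f d‖)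
    (fun d hd => div_nonneg (ha d hd) hA.le) (by rw [← Finset.sum_div, hsum, div_self hA.ne'])
    (fun d _ => norm_nonneg _) 4
  calc _ ≤ (A * ∑ d ∈ s, a d / A * ‖f d‖) ^ 4 := pow_le_pow_left₀ (norm_nonneg _) h1 4
    _ = A ^ 4 * (∑ d ∈ s, a d / A * ‖f d‖) ^ 4 := mul_pow _ _ _
    _ ≤ A ^ 4 * ∑ d ∈ s, a d / A * ‖f d‖ ^ 4 := by gcongr
    _ = _ := by
      rw [Finset.mul_sum, Finset.mul_sum]
      refine Finset.sum_congr rfl fun d _ => ?_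
      field_simp

variable {c h L : ℝ} {v : Fin 2 → Torus2 → ℝ}

lemma smoothTorus_walkWeight (hv : ∀ i, SmoothTorus (v i)) (d : Fin 2 × Bool) :
    SmoothTorus (walkWeight c v d) :=
  (SmoothTorus.const _).add ((hv d.1).const_mul _)

lemma torusPartial_walkWeight (hv : ∀ i, SmoothTorus (v i)) (d : Fin 2 × Bool) (j : Fin 2)
    (x : Torus2) :
    torusPartial j (walkWeight c v d) x = walkSign d.2 / 2 * torusPartial j (v d.1) x := by
  have h1 := (SmoothTorus.const (c / 2)).torusPartial_add
    ((hv d.1).const_mul (walkSign d.2 / 2)) j x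
  rw [(hv d.1).torusPartial_const_mul] at h1
  have h2 : torusPartial j (fun _ => c / 2) x = 0 :=
    torusPartial_eq_of_hasDerivAt (hasDerivAt_const _ _)
  rw [h2, zero_add] at h1
  exact h1

lemma abs_torusPartial_walkWeight_le (hv : ∀ i, SmoothTorus (v i))
    (hL : ∀ i j x, |torusPartial i (v j) x| ≤ L) (d : Fin 2 × Bool) (j : Fin 2) (x : Torus2) :
    |torusPartial j (walkWeight c v d) x| ≤ L / 2 := by
  rw [torusPartial_walkWeight hv, abs_mul, abs_div, abs_walkSign, abs_two]
  linarith [hL j d.1 x]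

lemma walkWeight_nonneg (hc : ∀ i x, |v i x| ≤ c) (d : Fin 2 × Bool) (x : Torus2) :
    0 ≤ walkWeight c v d x := by
  have h1 := abs_le.1 (hc d.1 x)
  obtain ⟨i, b⟩ := d
  cases b <;> simp only [walkWeight, walkSign] at h1 ⊢ <;> norm_num <;> linarith

/-- The total rate of the jumps that arrive at `x` exceeds the total rate `2c` of those that leave
`x` by at most `2hL`, as the rates have Lipschitz constant `L/2`. -/
lemma sum_walkWeight_comp_step_le (hv : ∀ i, SmoothTorus (v i))
    (hL : ∀ i j x, |torusPartial i (v j) x| ≤ L) (hh : 0 ≤ h) (x : Torus2) :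
    ∑ d, walkWeight c v d (x + walkStep h d) ≤ 2 * c + 2 * h * L := by
  have h1 (d : Fin 2 × Bool) : walkWeight c v d (x + walkStep h d)
      ≤ walkWeight c v d x + L / 2 * h := by
    have := (smoothTorus_walkWeight (c := c) hv d).abs_increment_le
      (fun x => abs_torusPartial_walkWeight_le hv hL d d.1 x) x (walkSign d.2 * h)
    rw [abs_mul, abs_walkSign, one_mul, abs_of_nonneg hh] at this
    have h2 := (abs_le.1 this).2
    simp only [walkStep]
    linarith
  refine (Finset.sum_le_sum fun d _ => h1 d).trans (le_of_eq ?_)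
  rw [Finset.sum_add_distrib, sum_walkWeight]
  simp
  ring

section Norm

variable {E : Type*} [NormedAddCommGroup E] [NormedSpace ℝ E] {f : Torus2 → E}

lemma memLp_walkOp (hv : ∀ i, SmoothTorus (v i)) {p : ℝ≥0∞} (hf : MemLp f p torusMeasure) :
    MemLp (walkOp c h v f) p torusMeasure := by
  refine memLp_finsetSum _ fun d _ => ?_
  obtain ⟨C, -, hC⟩ := (smoothTorus_walkWeight (c := c) hv d).exists_bound
  refine (memLp_comp_add hf (-walkStep h d)).of_le_mul (c := C)
    ((smoothTorus_walkWeight hv d).continuous.aestronglyMeasurable.smul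
      (memLp_comp_add hf _).1) (.of_forall fun x => ?_)
  rw [norm_smul]
  exact mul_le_mul_of_nonneg_right (hC x) (norm_nonneg _)

/-- Jensen's inequality with the weights of the departing jumps, and a change of variables to the
arriving jumps. -/
lemma lpNorm_walkOp_le (hv : ∀ i, SmoothTorus (v i))
    (hL : ∀ i j x, |torusPartial i (v j) x| ≤ L) (hL0 : 0 ≤ L) (hc0 : 0 < c)
    (hc : ∀ i x, |v i x| ≤ c) (hh : 0 ≤ h) (hf : MemLp f 4 torusMeasure) :
    lpNorm (walkOp c h v f) 4 torusMeasure
      ≤ (2 * c + 2 * h * L) * lpNorm f 4 torusMeasure := by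
  refine lpNorm_four_le_of_integral_le (mul_nonneg (by positivity) lpNorm_nonneg)
    (memLp_walkOp hv hf).1 ?_
  have hi := integrable_norm_pow_four_of_memLp hf
  have hid (d : Fin 2 × Bool) : Integrable
      (fun x => walkWeight c v d x * ‖f (x + -walkStep h d)‖ ^ 4) torusMeasure := by
    simpa only [mul_comm] using (smoothTorus_walkWeight hv d).integrable_mul
      (integrable_norm_pow_four_of_memLp (memLp_comp_add hf (-walkStep h d)))
  have hid' (d : Fin 2 × Bool) : Integrable
      (fun x => walkWeight c v d (x + walkStep h d) * ‖f x‖ ^ 4) torusMeasure := by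
    simpa only [mul_comm] using ((smoothTorus_walkWeight hv d).comp_add _).integrable_mul hi
  calc ∫ x, ‖walkOp c h v f x‖ ^ 4 ∂torusMeasure
      ≤ ∫ x, (2 * c) ^ 3 * ∑ d, walkWeight c v d x * ‖f (x + -walkStep h d)‖ ^ 4
          ∂torusMeasure := by
        refine integral_mono_of_nonneg (.of_forall fun x => by positivity)
          ((integrable_finsetSum _ fun d _ => hid d).const_mul _) (.of_forall fun x => ?_)
        exact norm_sum_smul_pow_four_le Finset.univ (fun d _ => walkWeight_nonneg hc d x)
          (by positivity) (sum_walkWeight c v x) fun d => f (x + -walkStep h d)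
    _ = (2 * c) ^ 3 * ∫ x, (∑ d, walkWeight c v d (x + walkStep h d)) * ‖f x‖ ^ 4
          ∂torusMeasure := by
        rw [integral_const_mul, integral_finsetSum _ fun d _ => hid d]
        simp only [Finset.sum_mul]
        rw [integral_finsetSum _ fun d _ => hid' d]
        congr 1
        refine Finset.sum_congr rfl fun d _ => ?_
        rw [← integral_add_torus _ (walkStep h d)]
        simp only [add_neg_cancel_right]
    _ ≤ (2 * c) ^ 3 * ∫ x, (2 * c + 2 * h * L) * ‖f x‖ ^ 4 ∂torusMeasure := by
        refine mul_le_mul_of_nonneg_left ?_ (by positivity)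
        refine integral_mono_of_nonneg (.of_forall fun x => ?_) (hi.const_mul _)
          (.of_forall fun x => ?_)
        · exact mul_nonneg (Finset.sum_nonneg fun d _ => walkWeight_nonneg hc d _) (by positivity)
        · exact mul_le_mul_of_nonneg_right (sum_walkWeight_comp_step_le hv hL hh x)
            (by positivity)
    _ ≤ (2 * c + 2 * h * L) ^ 3 * ∫ x, (2 * c + 2 * h * L) * ‖f x‖ ^ 4 ∂torusMeasure := by
        refine mul_le_mul_of_nonneg_right (pow_le_pow_left₀ (by positivity) ?_ 3)
          (integral_nonneg fun x => by positivity)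
        linarith [show 0 ≤ 2 * h * L by positivity]
    _ = _ := by
        rw [integral_const_mul, mul_pow, lpNorm_four_pow hf.1]
        ring

end Norm

lemma walkOp_sub (f f' : Torus2 → ℝ) (x : Torus2) :
    walkOp c h v (fun x => f x - f' x) x = walkOp c h v f x - walkOp c h v f' x := by
  simp [walkOp, mul_sub]

/-- The weak gradient of `walkOp c h v f`. As the rates have constant sum, only increments of `f`
enter the second term. -/
def walkGrad (c h : ℝ) (v : Fin 2 → Torus2 → ℝ) (f : Torus2 → ℝ) (g : Torus2 → Vec2)
    (x : Torus2) : Vec2 :=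
  walkOp c h v g x
    + ∑ d, (f (x + -walkStep h d) - f x) • torusGrad (walkWeight c v d) x

lemma sum_torusGrad_walkWeight (hv : ∀ i, SmoothTorus (v i)) (x : Torus2) :
    ∑ d, torusGrad (walkWeight c v d) x = 0 := by
  ext j
  simp [torusGrad, torusPartial_walkWeight hv, Fintype.sum_prod_type, walkSign]
  ring

lemma HasWeakGradient.walkOp (hv : ∀ i, SmoothTorus (v i)) {f : Torus2 → ℝ} {g : Torus2 → Vec2}
    (hf : HasWeakGradient f g) : HasWeakGradient (walkOp c h v f) (walkGrad c h v f g) := by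
  have h1 := HasWeakGradient.sum Finset.univ fun d _ =>
    (hf.comp_add (-walkStep h d)).smooth_mul (smoothTorus_walkWeight (c := c) hv d)
  have h2 : walkGrad c h v f g = fun x => ∑ d, (walkWeight c v d x • g (x + -walkStep h d)
      + f (x + -walkStep h d) • torusGrad (walkWeight c v d) x) := by
    ext1 x
    simp only [walkGrad, _root_.walkOp, sub_smul, Finset.sum_sub_distrib, Finset.sum_add_distrib,
      ← Finset.smul_sum, sum_torusGrad_walkWeight hv, smul_zero, sub_zero]
  rw [h2]
  exact h1

/-- The first term of `walkGrad` is bounded by `lpNorm_walkOp_le`. In each of the four summands of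
the second, the gradient of the rate is at most `L` and the increment of `f` at most `h |∇f|₄`. -/
lemma memLp_walkGrad_and_lpNorm_le (hv : ∀ i, SmoothTorus (v i))
    (hL : ∀ i j x, |torusPartial i (v j) x| ≤ L) (hL0 : 0 ≤ L) (hc0 : 0 < c)
    (hc : ∀ i x, |v i x| ≤ c) (hh : 0 ≤ h) {f : Torus2 → ℝ} {g : Torus2 → Vec2}
    (hfg : HasWeakGradient f g) (hf : MemLp f 4 torusMeasure) (hg : MemLp g 4 torusMeasure) :
    MemLp (walkGrad c h v f g) 4 torusMeasure ∧ lpNorm (walkGrad c h v f g) 4 torusMeasure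
      ≤ (2 * c + 6 * h * L) * lpNorm g 4 torusMeasure := by
  have hδ (d : Fin 2 × Bool) : MemLp (fun x => f (x + -walkStep h d) - f x) 4 torusMeasure :=
    (memLp_comp_add hf _).sub hf
  have hδn (d : Fin 2 × Bool) : lpNorm (fun x => f (x + -walkStep h d) - f x) 4 torusMeasure
      ≤ h * lpNorm g 4 torusMeasure := by
    have h1 := hfg.lpNorm_increment_le hf hg d.1 (-(walkSign d.2 * h))
    rwa [abs_neg, abs_mul, abs_walkSign, one_mul, abs_of_nonneg hh, axisStep_neg] at h1
  have hw (d : Fin 2 × Bool) (x : Torus2) : ‖torusGrad (walkWeight c v d) x‖ ≤ L := by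
    refine (norm_torusGrad_le fun j => abs_torusPartial_walkWeight_le hv hL d j x).trans ?_
    linarith
  have hmeas (d : Fin 2 × Bool) : AEStronglyMeasurable
      (fun x => (f (x + -walkStep h d) - f x) • torusGrad (walkWeight c v d) x) torusMeasure :=
    (hδ d).1.smul (smoothTorus_walkWeight hv d).continuous_torusGrad.aestronglyMeasurable
  have hle (d : Fin 2 × Bool) (x : Torus2) :
      ‖(f (x + -walkStep h d) - f x) • torusGrad (walkWeight c v d) x‖
        ≤ L * ‖f (x + -walkStep h d) - f x‖ := by
    rw [norm_smul, mul_comm]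
    exact mul_le_mul_of_nonneg_right (hw d x) (norm_nonneg _)
  have hm (d : Fin 2 × Bool) : MemLp
      (fun x => (f (x + -walkStep h d) - f x) • torusGrad (walkWeight c v d) x) 4 torusMeasure :=
    (hδ d).of_le_mul (hmeas d) (.of_forall (hle d))
  refine ⟨(memLp_walkOp hv hg).add (memLp_finsetSum _ fun d _ => hm d), ?_⟩
  refine (lpNorm_add_le (memLp_walkOp hv hg) (by norm_num)).trans ?_
  have h2 := lpNorm_walkOp_le hv hL hL0 hc0 hc hh hg
  have h3 : lpNorm (fun x => ∑ d, (f (x + -walkStep h d) - f x) • torusGrad (walkWeight c v d) x)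
      4 torusMeasure ≤ 4 * (L * (h * lpNorm g 4 torusMeasure)) := by
    refine (lpNorm_sum_le_torus _ fun d _ => hm d).trans ?_
    refine (Finset.sum_le_sum fun d _ => (lpNorm_le_of_norm_le hL0 (hmeas d) (hδ d) (hle d)).trans
      (mul_le_mul_of_nonneg_left (hδn d) hL0)).trans (le_of_eq ?_)
    simp
  calc _ ≤ _ := add_le_add h2 h3
    _ = _ := by ring

end Walk

/-! ### Stationary transport by a smooth field -/

section SmoothTransport

variable {c h L τ : ℝ} {v : Fin 2 → Torus2 → ℝ} {ξ : Torus2 → ℝ} {γ : Torus2 → Vec2}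

/-- One step of the iteration for `(h + 2cτ) f = h ξ + τ walkOp f`, a discretization of
`f + τ v · ∇f = ξ`. -/
def walkNext (c h τ : ℝ) (v : Fin 2 → Torus2 → ℝ) (ξ f : Torus2 → ℝ) (x : Torus2) : ℝ :=
  (h + 2 * c * τ)⁻¹ * (h * ξ x + τ * walkOp c h v f x)

/-- The weak gradient of `walkNext`. -/
def walkNextGrad (c h τ : ℝ) (v : Fin 2 → Torus2 → ℝ) (γ : Torus2 → Vec2) (f : Torus2 → ℝ)
    (g : Torus2 → Vec2) (x : Torus2) : Vec2 :=
  (h + 2 * c * τ)⁻¹ • (h • γ x + τ • walkGrad c h v f g x)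

/-- If an affine step contracts with the stated rates, then it preserves the bound
`|w|₄ / (1 - s)`. -/
lemma walk_step_bound {E : Type*} [NormedAddCommGroup E] [NormedSpace ℝ E] {Q w : Torus2 → E}
    {B s : ℝ} (hc0 : 0 < c) (hh : 0 < h) (hτ : 0 < τ) (hs : s < 1) (hw : MemLp w 4 torusMeasure)
    (hB : B ≤ lpNorm w 4 torusMeasure / (1 - s))
    (hQB : τ * lpNorm Q 4 torusMeasure ≤ (2 * c * τ + h * s) * B) (hs0 : 0 ≤ s) :
    lpNorm (fun x => (h + 2 * c * τ)⁻¹ • (h • w x + τ • Q x)) 4 torusMeasure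
      ≤ lpNorm w 4 torusMeasure / (1 - s) := by
  have hpos : 0 < h + 2 * c * τ := by positivity
  have h1 : lpNorm (fun x => (h + 2 * c * τ)⁻¹ • (h • w x + τ • Q x)) 4 torusMeasure
      ≤ (h + 2 * c * τ)⁻¹ * (h * lpNorm w 4 torusMeasure + τ * lpNorm Q 4 torusMeasure) := by
    have h2 := lpNorm_const_smul (p := 4) (h + 2 * c * τ)⁻¹ (fun x => h • w x + τ • Q x)
      torusMeasure
    have h3 := lpNorm_add_le (p := 4) (μ := torusMeasure) (f := fun x => h • w x)
      (g := fun x => τ • Q x) (hw.const_smul h) (by norm_num)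
    have h4 := lpNorm_const_smul (p := 4) h w torusMeasure
    have h5 := lpNorm_const_smul (p := 4) τ Q torusMeasure
    simp only [coe_nnnorm, Real.norm_eq_abs, abs_of_pos hh, abs_of_pos hτ,
      abs_of_pos (inv_pos.2 hpos)] at h2 h4 h5
    refine h2.le.trans (mul_le_mul_of_nonneg_left (h3.trans ?_) (inv_pos.2 hpos).le)
    exact add_le_add h4.le h5.le
  refine h1.trans ?_
  rw [inv_mul_le_iff₀ hpos]
  have h6 : (2 * c * τ + h * s) * B
      ≤ (2 * c * τ + h * s) * (lpNorm w 4 torusMeasure / (1 - s)) :=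
    mul_le_mul_of_nonneg_left hB (by positivity)
  have h7 : lpNorm w 4 torusMeasure = (1 - s) * (lpNorm w 4 torusMeasure / (1 - s)) := by
    field_simp [(sub_pos.2 hs).ne']
  nlinarith

/-- Approximate solutions of the discretized equation, with uniform bounds: `f` and `f'` are
successive iterates of `walkNext`, which contracts in `L⁴`. The iteration runs on pairs of a
function and its weak gradient, and no convergence of the gradients is needed. -/
lemma exists_approx_solution (hv : ∀ i, SmoothTorus (v i))
    (hL : ∀ i j x, |torusPartial i (v j) x| ≤ L) (hL0 : 0 ≤ L) (hc0 : 0 < c)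
    (hc : ∀ i x, |v i x| ≤ c) (hh : 0 < h) (hτ : 0 < τ) (hs : 6 * τ * L < 1)
    (hξγ : HasWeakGradient ξ γ) (hξ : MemLp ξ 4 torusMeasure) (hγ : MemLp γ 4 torusMeasure)
    {ε : ℝ} (hε : 0 < ε) :
    ∃ f f' : Torus2 → ℝ, ∃ g' : Torus2 → Vec2, MemLp f 4 torusMeasure ∧
      MemLp f' 4 torusMeasure ∧ MemLp g' 4 torusMeasure ∧ HasWeakGradient f' g' ∧
      lpNorm f' 4 torusMeasure ≤ lpNorm ξ 4 torusMeasure / (1 - 6 * τ * L) ∧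
      lpNorm g' 4 torusMeasure ≤ lpNorm γ 4 torusMeasure / (1 - 6 * τ * L) ∧
      (∀ x, (h + 2 * c * τ) * f' x = h * ξ x + τ * walkOp c h v f x) ∧
      lpNorm (fun x => f' x - f x) 4 torusMeasure ≤ ε := by
  have hpos : 0 < h + 2 * c * τ := by positivity
  have hs0 : 0 ≤ 6 * τ * L := by positivity
  let Φ : (Torus2 → ℝ) × (Torus2 → Vec2) → (Torus2 → ℝ) × (Torus2 → Vec2) := fun p =>
    (walkNext c h τ v ξ p.1, walkNextGrad c h τ v γ p.1 p.2)
  let p : ℕ → (Torus2 → ℝ) × (Torus2 → Vec2) := fun n => Φ^[n] (fun _ => 0, fun _ => 0)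
  have hp (n : ℕ) : p (n + 1) = Φ (p n) := Function.iterate_succ_apply' Φ n _
  have hinv (n : ℕ) : HasWeakGradient (p n).1 (p n).2 ∧ MemLp (p n).1 4 torusMeasure ∧
      MemLp (p n).2 4 torusMeasure ∧
      lpNorm (p n).1 4 torusMeasure ≤ lpNorm ξ 4 torusMeasure / (1 - 6 * τ * L) ∧
      lpNorm (p n).2 4 torusMeasure ≤ lpNorm γ 4 torusMeasure / (1 - 6 * τ * L) := by
    induction n with
    | zero =>
      refine ⟨HasWeakGradient.zero, MemLp.zero', MemLp.zero', ?_, ?_⟩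
      · simpa [p] using div_nonneg lpNorm_nonneg (sub_pos.2 hs).le
      · simpa [p] using div_nonneg lpNorm_nonneg (sub_pos.2 hs).le
    | succ n ih =>
      obtain ⟨ih1, ih2, ih3, ih4, ih5⟩ := ih
      rw [hp]
      have hP := memLp_walkOp (c := c) (h := h) hv ih2
      have hPn := lpNorm_walkOp_le hv hL hL0 hc0 hc hh.le ih2
      obtain ⟨hQ, hQn⟩ := memLp_walkGrad_and_lpNorm_le hv hL hL0 hc0 hc hh.le ih1 ih2 ih3
      refine ⟨((hξγ.const_mul h).add ((ih1.walkOp hv).const_mul τ)).const_mul _,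
        ((hξ.const_mul h).add (hP.const_mul τ)).const_mul _,
        ((hγ.const_smul h).add (hQ.const_smul τ)).const_smul (h + 2 * c * τ)⁻¹,
        walk_step_bound (Q := walkOp c h v (p n).1) hc0 hh hτ hs hξ ih4 ?_ hs0,
        walk_step_bound (Q := walkGrad c h v (p n).1 (p n).2) hc0 hh hτ hs hγ ih5 ?_ hs0⟩
      · have h1 : (0 : ℝ) ≤ h * τ * L * lpNorm (p n).1 4 torusMeasure :=
          mul_nonneg (by positivity) lpNorm_nonneg
        have h2 := mul_le_mul_of_nonneg_left hPn hτ.le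
        linarith
      · have h2 := mul_le_mul_of_nonneg_left hQn hτ.le
        linarith
  let q : ℝ := τ * (2 * c + 2 * h * L) / (h + 2 * c * τ)
  have hq0 : 0 ≤ q := by positivity
  have hq1 : q < 1 := by
    rw [div_lt_one hpos]
    nlinarith [mul_nonneg hτ.le hL0]
  have hdiff (n : ℕ) : lpNorm (fun x => (p (n + 1)).1 x - (p n).1 x) 4 torusMeasure
      ≤ lpNorm (p 1).1 4 torusMeasure * q ^ n := by
    induction n with
    | zero => simp [p]
    | succ n ih =>
      have hm : MemLp (fun x => (p (n + 1)).1 x - (p n).1 x) 4 torusMeasure :=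
        (hinv (n + 1)).2.1.sub (hinv n).2.1
      have heq : (fun x => (p (n + 1 + 1)).1 x - (p (n + 1)).1 x) =
          ((h + 2 * c * τ)⁻¹ * τ) • walkOp c h v (fun x => (p (n + 1)).1 x - (p n).1 x) := by
        ext1 x
        rw [hp (n + 1), Pi.smul_apply, walkOp_sub]
        conv_lhs => rw [show (p (n + 1)).1 x = (Φ (p n)).1 x by rw [← hp]]
        simp only [Φ, walkNext, smul_eq_mul]
        ring
      rw [heq, lpNorm_const_smul, coe_nnnorm, Real.norm_of_nonneg (by positivity)]
      have h1 := lpNorm_walkOp_le hv hL hL0 hc0 hc hh.le hm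
      calc _ ≤ (h + 2 * c * τ)⁻¹ * τ * ((2 * c + 2 * h * L) *
            (lpNorm (p 1).1 4 torusMeasure * q ^ n)) := by
            refine mul_le_mul_of_nonneg_left (h1.trans ?_) (by positivity)
            exact mul_le_mul_of_nonneg_left ih (by positivity)
        _ = _ := by simp only [q]; ring
  have hlim : Tendsto (fun n => lpNorm (p 1).1 4 torusMeasure * q ^ n) atTop (𝓝 0) := by
    simpa using (tendsto_pow_atTop_nhds_zero_of_lt_one hq0 hq1).const_mul
      (lpNorm (p 1).1 4 torusMeasure)
  obtain ⟨n, hn⟩ := (hlim.eventually (ge_mem_nhds hε)).exists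
  obtain ⟨h1, h2, h3, h4, h5⟩ := hinv (n + 1)
  refine ⟨(p n).1, (p (n + 1)).1, (p (n + 1)).2, (hinv n).2.1, h2, h3, h1, h4, h5, fun x => ?_,
    (hdiff n).trans hn⟩
  rw [hp]
  exact mul_inv_cancel_left₀ hpos.ne' _

/-- The divergence form `-∑ᵢ ∂ᵢ(vᵢ φ)` of the transport operator applied to a test function. -/
def transportDual (v : Fin 2 → Torus2 → ℝ) (φ : Torus2 → ℝ) (x : Torus2) : ℝ :=
  -∑ i, torusPartial i (fun x => v i x * φ x) x

lemma smoothTorus_transportDual (hv : ∀ i, SmoothTorus (v i)) {φ : Torus2 → ℝ}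
    (hφ : SmoothTorus φ) : SmoothTorus (transportDual v φ) := by
  have h1 := (SmoothTorus.sum (s := Finset.univ) fun i _ =>
    ((hv i).mul hφ).torusPartial i).const_mul (-1)
  simpa only [neg_one_mul] using! h1

/-- The weak form of `v · ∇f`, for a field that need not be incompressible. -/
lemma HasWeakGradient.integral_mul_transportDual (hv : ∀ i, SmoothTorus (v i)) {φ : Torus2 → ℝ}
    (hφ : SmoothTorus φ) {f : Torus2 → ℝ} {g : Torus2 → Vec2} (h : HasWeakGradient f g) :
    ∫ x, f x * transportDual v φ x ∂torusMeasure
      = ∫ x, (∑ i, v i x * g x i) * φ x ∂torusMeasure := by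
  simp only [transportDual, mul_neg, Finset.mul_sum, Finset.sum_mul]
  rw [integral_neg, integral_finsetSum _ fun i _ =>
    (((hv i).mul hφ).torusPartial i).integrable_mul h.1, integral_finsetSum,
    ← Finset.sum_neg_distrib]
  · refine Finset.sum_congr rfl fun i _ => ?_
    rw [h.2.2 _ ((hv i).mul hφ) i, neg_neg]
    exact integral_congr_ae (.of_forall fun x => by ring)
  · intro i _
    refine (((hv i).mul hφ).integrable_mul (h.integrable_apply i)).congr (.of_forall fun x => ?_)
    simp only
    ring

/-- Consistency of the discretization, in dual form. -/
lemma exists_walk_consistency (hv : ∀ i, SmoothTorus (v i)) {φ : Torus2 → ℝ}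
    (hφ : SmoothTorus φ) : ∃ C, 0 ≤ C ∧ ∀ h x,
      |∑ d, (walkWeight c v d x * φ x
        - walkWeight c v d (x + walkStep h d) * φ (x + walkStep h d))
        - h * transportDual v φ x| ≤ C * h ^ 2 := by
  have hw (d : Fin 2 × Bool) : SmoothTorus fun x => walkWeight c v d x * φ x :=
    (smoothTorus_walkWeight hv d).mul hφ
  choose C hC0 hC using fun d : Fin 2 × Bool => (hw d).exists_taylor_bound d.1
  refine ⟨∑ d, C d, Finset.sum_nonneg fun d _ => hC0 d, fun h x => ?_⟩
  have hpart (d : Fin 2 × Bool) : torusPartial d.1 (fun x => walkWeight c v d x * φ x) x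
      = walkSign d.2 / 2 * torusPartial d.1 (v d.1) x * φ x
        + walkWeight c v d x * torusPartial d.1 φ x := by
    rw [(smoothTorus_walkWeight hv d).torusPartial_mul hφ, torusPartial_walkWeight hv]
  have hdual : h * transportDual v φ x = -∑ d : Fin 2 × Bool, (walkSign d.2 * h) *
      torusPartial d.1 (fun x => walkWeight c v d x * φ x) x := by
    rw [Finset.sum_congr rfl fun d _ => congrArg (walkSign d.2 * h * ·) (hpart d)]
    simp only [transportDual, (hv _).torusPartial_mul hφ, Fintype.sum_prod_type,
      walkWeight, walkSign, Fintype.sum_bool, Fin.sum_univ_two]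
    simp
    ring
  rw [hdual, sub_neg_eq_add, ← Finset.sum_add_distrib, Finset.sum_mul]
  refine (Finset.abs_sum_le_sum_abs _ _).trans (Finset.sum_le_sum fun d _ => ?_)
  have h1 := hC d x (walkSign d.2 * h)
  rw [mul_pow, ← sq_abs (walkSign d.2), abs_walkSign, one_pow, one_mul] at h1
  rw [← abs_neg]
  refine le_trans (le_of_eq ?_) h1
  simp only [walkStep]
  congr 1
  ring

/-- The difference operator `2c - walkOp`, moved to the test function by translation. -/
lemma integral_walk_dual (hv : ∀ i, SmoothTorus (v i)) {φ : Torus2 → ℝ}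
    (hφ : SmoothTorus φ) {f : Torus2 → ℝ} (hf : Integrable f torusMeasure) :
    ∫ x, (2 * c * f x - walkOp c h v f x) * φ x ∂torusMeasure
      = ∫ x, f x * ∑ d, (walkWeight c v d x * φ x
        - walkWeight c v d (x + walkStep h d) * φ (x + walkStep h d)) ∂torusMeasure := by
  have hw (d : Fin 2 × Bool) : SmoothTorus fun x => walkWeight c v d x * φ x :=
    (smoothTorus_walkWeight hv d).mul hφ
  have hi1 (d : Fin 2 × Bool) :
      Integrable (fun x => f x * (walkWeight c v d x * φ x)) torusMeasure :=
    (hw d).integrable_mul hf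
  have hi2 (d : Fin 2 × Bool) : Integrable
      (fun x => f (x + -walkStep h d) * (walkWeight c v d x * φ x)) torusMeasure :=
    (hw d).integrable_mul ((measurePreserving_add_torus _).integrable_comp_of_integrable hf)
  have hi3 (d : Fin 2 × Bool) : Integrable
      (fun x => f x * (walkWeight c v d (x + walkStep h d) * φ (x + walkStep h d)))
      torusMeasure := ((hw d).comp_add (walkStep h d)).integrable_mul hf
  have h1 : ∫ x, (2 * c * f x - walkOp c h v f x) * φ x ∂torusMeasure
      = ∑ d, (∫ x, f x * (walkWeight c v d x * φ x) ∂torusMeasure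
        - ∫ x, f (x + -walkStep h d) * (walkWeight c v d x * φ x) ∂torusMeasure) := by
    have hi12 (d : Fin 2 × Bool) : Integrable (fun x => f x * (walkWeight c v d x * φ x)
        - f (x + -walkStep h d) * (walkWeight c v d x * φ x)) torusMeasure := (hi1 d).sub (hi2 d)
    simp only [← integral_sub (hi1 _) (hi2 _)]
    rw [← integral_finsetSum _ fun d _ => hi12 d]
    refine integral_congr_ae (.of_forall fun x => ?_)
    simp only [← sum_walkWeight c v x, walkOp, Finset.sum_mul, smul_eq_mul,
      ← Finset.sum_sub_distrib]
    exact Finset.sum_congr rfl fun d _ => by ring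
  have hi13 (d : Fin 2 × Bool) : Integrable (fun x => f x * (walkWeight c v d x * φ x)
      - f x * (walkWeight c v d (x + walkStep h d) * φ (x + walkStep h d))) torusMeasure :=
    (hi1 d).sub (hi3 d)
  rw [h1]
  simp only [Finset.mul_sum, mul_sub]
  rw [integral_finsetSum _ fun d _ => hi13 d]
  refine Finset.sum_congr rfl fun d _ => ?_
  rw [integral_sub (hi1 d) (hi3 d), ← integral_add_torus
    (fun x => f (x + -walkStep h d) * (walkWeight c v d x * φ x)) (walkStep h d)]
  simp only [add_neg_cancel_right]

/-- Solvability of `f + τ v · ∇f = ξ` in `W^{1,4}` for a smooth field `v` and `6 τ |∇v| < 1`. -/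
lemma exists_solution_smooth (hv : ∀ i, SmoothTorus (v i))
    (hL : ∀ i j x, |torusPartial i (v j) x| ≤ L) (hτ : 0 < τ) (hs : 6 * τ * L < 1)
    (hξγ : HasWeakGradient ξ γ) (hξ : MemLp ξ 4 torusMeasure) (hγ : MemLp γ 4 torusMeasure) :
    ∃ f : Torus2 → ℝ, ∃ g : Torus2 → Vec2, HasWeakGradient f g ∧ MemLp f 4 torusMeasure ∧
      MemLp g 4 torusMeasure ∧
      lpNorm f 4 torusMeasure ≤ lpNorm ξ 4 torusMeasure / (1 - 6 * τ * L) ∧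
      lpNorm g 4 torusMeasure ≤ lpNorm γ 4 torusMeasure / (1 - 6 * τ * L) ∧
      ∀ᵐ x ∂torusMeasure, f x + τ * ∑ i, v i x * g x i = ξ x := by
  have hL0 : 0 ≤ L := (abs_nonneg _).trans (hL 0 0 0)
  obtain ⟨C0, hC00, hC0⟩ := (hv 0).exists_bound
  obtain ⟨C1, hC10, hC1⟩ := (hv 1).exists_bound
  obtain ⟨c, hc0, hc⟩ : ∃ c, 0 < c ∧ ∀ i x, |v i x| ≤ c := by
    refine ⟨C0 + C1 + 1, by positivity, fun i x => ?_⟩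
    fin_cases i
    · exact (hC0 x).trans (by linarith)
    · exact (hC1 x).trans (by linarith)
  let η : ℕ → ℝ := fun m => 1 / ((m : ℝ) + 1)
  have hη (m : ℕ) : 0 < η m := by positivity
  have hη0 : Tendsto η atTop (𝓝 0) := tendsto_one_div_add_atTop_nhds_zero_nat
  have hη1 (m : ℕ) : η m ≤ 1 := by
    simp only [η]
    rw [div_le_one (by positivity)]
    linarith [(Nat.cast_nonneg m : (0 : ℝ) ≤ m)]
  choose f f' g' hf hf' hg' hfg' hfb hgb heq herr using fun m : ℕ =>
    exists_approx_solution hv hL hL0 hc0 hc (hη m) hτ hs hξγ hξ hγ (pow_pos (hη m) 2)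
  have hA : 0 ≤ lpNorm ξ 4 torusMeasure / (1 - 6 * τ * L) :=
    div_nonneg lpNorm_nonneg (sub_pos.2 hs).le
  have hB : 0 ≤ lpNorm γ 4 torusMeasure / (1 - 6 * τ * L) :=
    div_nonneg lpNorm_nonneg (sub_pos.2 hs).le
  obtain ⟨F, hF2, hF⟩ := exists_weakTendsto (Filter.hyperfilter ℕ)
    (fun m => memLp_two_of_four (hf' m)) fun m => (lpNorm_two_le_four (hf' m)).trans (hfb m)
  obtain ⟨G, hG2, hG⟩ := exists_weakTendsto (Filter.hyperfilter ℕ)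
    (fun m => memLp_two_of_four (hg' m)) fun m => (lpNorm_two_le_four (hg' m)).trans (hgb m)
  obtain ⟨hF4, hFA⟩ := hF.lpNorm_four_le hF2 hA hf' hfb
  obtain ⟨hG4, hGB⟩ := hG.lpNorm_four_le hG2 hB hg' hgb
  have hFG := hF.hasWeakGradient hG hF2 hG2 hfg'
  refine ⟨F, G, hFG, hF4, hG4, hFA, hGB, ?_⟩
  have hvG : Integrable (fun x => ∑ i, v i x * G x i) torusMeasure :=
    integrable_finsetSum _ fun i _ => by
      simpa only [mul_comm] using (hv i).integrable_mul (hFG.integrable_apply i)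
  refine ae_eq_of_forall_smooth (hF2.integrable (by norm_num) |>.add (hvG.const_mul τ)) hξγ.1
    fun φ hφ => ?_
  have hdual := smoothTorus_transportDual hv hφ
  obtain ⟨C, hC0, hC⟩ := exists_walk_consistency (c := c) hv hφ
  have hφ2 := hφ.memLp 2
  -- the weak form of the discrete equation, up to an error of order `η m`
  have hres (m : ℕ) : |∫ x, f' m x * φ x ∂torusMeasure
      + τ * ∫ x, f' m x * transportDual v φ x ∂torusMeasure
      - ∫ x, ξ x * φ x ∂torusMeasure|
      ≤ η m * (τ * (C * (lpNorm ξ 4 torusMeasure / (1 - 6 * τ * L)))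
        + τ * ((2 * c + 2 * L) * lpNorm φ 2 torusMeasure)) := by
    have hδ : MemLp (fun x => f' m x - f m x) 4 torusMeasure := (hf' m).sub (hf m)
    have hPδ := memLp_walkOp (c := c) (h := η m) hv hδ
    have hif' := (hf' m).integrable (by norm_num)
    have hiP : Integrable (walkOp c (η m) v (f' m)) torusMeasure :=
      (memLp_walkOp hv (hf' m)).integrable (by norm_num)
    have hi1 := hφ.integrable_mul hif'
    have hi3 : Integrable (fun x => (2 * c * f' m x - walkOp c (η m) v (f' m) x) * φ x)
        torusMeasure := hφ.integrable_mul ((hif'.const_mul (2 * c)).sub hiP)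
    have hi4 := hφ.integrable_mul (hPδ.integrable (by norm_num))
    let R : Torus2 → ℝ := fun x => ∑ d, (walkWeight c v d x * φ x
      - walkWeight c v d (x + walkStep (η m) d) * φ (x + walkStep (η m) d))
    have hR : SmoothTorus R := SmoothTorus.sum fun d _ =>
      ((smoothTorus_walkWeight hv d).mul hφ).sub
        (((smoothTorus_walkWeight hv d).mul hφ).comp_add _)
    have hiR := hR.integrable_mul hif'
    have hiT := hdual.integrable_mul hif'
    have hE1 : |∫ x, f' m x * R x ∂torusMeasure
        - η m * ∫ x, f' m x * transportDual v φ x ∂torusMeasure|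
        ≤ C * η m ^ 2 * (lpNorm ξ 4 torusMeasure / (1 - 6 * τ * L)) := by
      rw [← integral_const_mul, ← integral_sub hiR (hiT.const_mul _)]
      refine (norm_integral_le_integral_norm (G := ℝ) _).trans ?_
      calc _ ≤ ∫ x, C * η m ^ 2 * ‖f' m x‖ ∂torusMeasure := by
            refine integral_mono_of_nonneg (.of_forall fun x => norm_nonneg _)
              (hif'.norm.const_mul _) (.of_forall fun x => ?_)
            have h1 := mul_le_mul_of_nonneg_left (hC (η m) x) (abs_nonneg (f' m x))
            rw [← abs_mul] at h1
            simp only [Real.norm_eq_abs]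
            rw [mul_comm (C * _)]
            refine le_trans (le_of_eq ?_) h1
            congr 1
            simp only [R]
            ring
        _ = C * η m ^ 2 * lpNorm (f' m) 1 torusMeasure := by
            rw [integral_const_mul, lpNorm_one_eq_integral_norm hif'.1]
        _ ≤ _ := mul_le_mul_of_nonneg_left
            ((lpNorm_mono_exponent (by norm_num) (hf' m)).trans (hfb m))
            (mul_nonneg hC0 (sq_nonneg _))
    have hE2 : |∫ x, walkOp c (η m) v (fun x => f' m x - f m x) x * φ x ∂torusMeasure|
        ≤ (2 * c + 2 * L) * η m ^ 2 * lpNorm φ 2 torusMeasure := by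
      refine (abs_integral_mul_le (memLp_two_of_four hPδ) hφ2).trans ?_
      refine mul_le_mul_of_nonneg_right ?_ lpNorm_nonneg
      refine (lpNorm_two_le_four hPδ).trans ((lpNorm_walkOp_le hv hL hL0 hc0 hc (hη m).le hδ).trans
        (mul_le_mul ?_ (herr m) lpNorm_nonneg (by positivity)))
      nlinarith [hη1 m]
    have hi13 : Integrable (fun x => η m * (f' m x * φ x)
        + τ * ((2 * c * f' m x - walkOp c (η m) v (f' m) x) * φ x)) torusMeasure :=
      (hi1.const_mul _).add (hi3.const_mul _)
    have hweak : η m * ∫ x, f' m x * φ x ∂torusMeasure + τ * ∫ x, f' m x * R x ∂torusMeasure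
        + τ * ∫ x, walkOp c (η m) v (fun x => f' m x - f m x) x * φ x ∂torusMeasure
        = η m * ∫ x, ξ x * φ x ∂torusMeasure := by
      rw [← integral_walk_dual hv hφ hif', ← integral_const_mul, ← integral_const_mul,
        ← integral_const_mul, ← integral_const_mul,
        ← integral_add (hi1.const_mul _) (hi3.const_mul _), ← integral_add hi13
        (hi4.const_mul _)]
      refine integral_congr_ae (.of_forall fun x => ?_)
      have h1 := heq m x
      simp only [walkOp_sub]
      linear_combination φ x * h1
    have h3 := abs_le.1 hE1
    have h4 := abs_le.1 hE2
    have h5 := mul_le_mul_of_nonneg_left h3.1 hτ.le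
    have h6 := mul_le_mul_of_nonneg_left h3.2 hτ.le
    have h7 := mul_le_mul_of_nonneg_left h4.1 hτ.le
    have h8 := mul_le_mul_of_nonneg_left h4.2 hτ.le
    refine le_of_mul_le_mul_left ?_ (hη m)
    rw [← abs_of_pos (hη m), ← abs_mul, abs_of_pos (hη m), abs_le]
    constructor <;> linarith
  have hlim1 : Tendsto (fun m => ∫ x, f' m x * φ x ∂torusMeasure
      + τ * ∫ x, f' m x * transportDual v φ x ∂torusMeasure
      - ∫ x, ξ x * φ x ∂torusMeasure) (Filter.hyperfilter ℕ : Filter ℕ) (𝓝 0) := by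
    refine Tendsto.mono_left ?_ (Nat.hyperfilter_le_atTop)
    refine squeeze_zero_norm hres ?_
    simpa using hη0.mul_const _
  have hlim2 := ((hF.integral_mul hφ2).add
    ((hF.integral_mul (hdual.memLp 2)).const_mul τ)).sub_const (∫ x, ξ x * φ x ∂torusMeasure)
  have h1 := tendsto_nhds_unique hlim2 hlim1
  rw [hFG.integral_mul_transportDual hv hφ] at h1
  simp only [add_mul, mul_assoc]
  rw [integral_add (hφ.integrable_mul hFG.1), integral_const_mul]
  · linarith
  · simpa only [mul_assoc] using (hφ.integrable_mul hvG).const_mul τ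

end SmoothTransport

/-! ### Fourier series in one variable -/

section OneVariable

open AddCircle

/-- Abel summation: a geometric sum with nonincreasing nonnegative weights. -/
lemma norm_one_sub_mul_sum_le {b : ℕ → ℝ} (hb : Antitone b) (hb0 : ∀ k, 0 ≤ b k) {z : ℂ}
    (hz : ‖z‖ = 1) (n : ℕ) :
    ‖(1 - z) * ∑ k ∈ Finset.range n, (b k : ℂ) * z ^ k‖ ≤ 2 * b 0 := by
  have key : ‖(1 - z) * ∑ k ∈ Finset.range n, (b k : ℂ) * z ^ k + b n * z ^ n‖
      ≤ b 0 + (b 0 - b n) := by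
    induction n with
    | zero => simp [abs_of_nonneg (hb0 0)]
    | succ n ih =>
      have h1 : (1 - z) * ∑ k ∈ Finset.range (n + 1), (b k : ℂ) * z ^ k + b (n + 1) * z ^ (n + 1)
          = ((1 - z) * ∑ k ∈ Finset.range n, (b k : ℂ) * z ^ k + b n * z ^ n)
            + ((b (n + 1) - b n : ℝ) : ℂ) * z ^ (n + 1) := by
        rw [Finset.sum_range_succ]
        push_cast
        ring
      rw [h1]
      refine (norm_add_le _ _).trans ?_
      have h2 : ‖((b (n + 1) - b n : ℝ) : ℂ) * z ^ (n + 1)‖ = b n - b (n + 1) := by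
        rw [norm_mul, norm_pow, hz, one_pow, mul_one, Complex.norm_real, Real.norm_eq_abs,
          abs_sub_comm, abs_of_nonneg (sub_nonneg.2 (hb n.le_succ))]
      rw [h2]
      linarith
  have h3 : ‖(b n : ℂ) * z ^ n‖ = b n := by
    rw [norm_mul, norm_pow, hz, one_pow, mul_one, Complex.norm_real,
      Real.norm_of_nonneg (hb0 n)]
  have h4 := norm_sub_le ((1 - z) * ∑ k ∈ Finset.range n, (b k : ℂ) * z ^ k + b n * z ^ n)
    ((b n : ℂ) * z ^ n)
  rw [add_sub_cancel_right, h3] at h4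
  linarith

/-- A bound uniform in `a`, by comparison with the telescoping sum of `2a / (a + k)`. -/
lemma sum_div_sq_add_sq_le {a : ℝ} (ha : 1 ≤ a) (n : ℕ) :
    ∑ k ∈ Finset.range n, a / (a ^ 2 + (k : ℝ) ^ 2) ≤ 3 := by
  have key : ∑ k ∈ Finset.range (n + 1), a / (a ^ 2 + (k : ℝ) ^ 2) ≤ 3 - 2 * a / (a + n) := by
    induction n with
    | zero =>
      have h1 : a / a ^ 2 ≤ 1 := by
        rw [div_le_one (by positivity)]
        nlinarith
      simp only [zero_add, Finset.sum_range_one, Nat.cast_zero, add_zero]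
      rw [mul_div_assoc, div_self (by positivity)]
      norm_num
      linarith
    | succ n ih =>
      rw [Finset.sum_range_succ]
      have h2 : a / (a ^ 2 + ((n + 1 : ℕ) : ℝ) ^ 2)
          ≤ 2 * a / (a + n) - 2 * a / (a + (n + 1 : ℕ)) := by
        push_cast
        have hn : (0 : ℝ) ≤ n := Nat.cast_nonneg n
        rw [div_sub_div _ _ (by positivity) (by positivity), div_le_div_iff₀ (by positivity)
          (by positivity)]
        nlinarith [sq_nonneg (a - (n + 1)), mul_nonneg (by linarith : 0 ≤ a) hn]
      linarith
  cases n with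
  | zero => simp
  | succ n =>
    refine le_trans ?_ (key.trans (sub_le_self _ (by positivity)))
    exact Finset.sum_le_sum_of_subset_of_nonneg (Finset.range_mono (by omega))
      fun k _ _ => by positivity

lemma sum_Icc_neg_eq {E : Type*} [AddCommGroup E] (f : ℤ → E) (M : ℕ) :
    ∑ b ∈ Finset.Icc (-M : ℤ) M, f b
      = ∑ k ∈ Finset.range (M + 1), f k + ∑ k ∈ Finset.range (M + 1), f (-k) - f 0 := by
  induction M with
  | zero => simp
  | succ M ih =>
    have h1 : Finset.Icc (-(M + 1 : ℕ) : ℤ) (M + 1 : ℕ)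
        = insert ((M + 1 : ℕ) : ℤ) (insert (-((M + 1 : ℕ) : ℤ)) (Finset.Icc (-M : ℤ) M)) := by
      ext b
      simp only [Finset.mem_Icc, Finset.mem_insert]
      omega
    rw [h1, Finset.sum_insert, Finset.sum_insert, ih, Finset.sum_range_succ _ (M + 1),
      Finset.sum_range_succ _ (M + 1)]
    · abel
    · simp
    · simp only [Finset.mem_insert, Finset.mem_Icc]
      omega

/-- The partial Fourier sum in the second variable of the kernel with coefficients
`a / (a² + b²)`. -/
def stripSum (M : ℕ) (a : ℤ) (y : UnitAddCircle) : ℂ :=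
  ∑ b ∈ Finset.Icc (-M : ℤ) M, ((a / ((a : ℝ) ^ 2 + (b : ℝ) ^ 2) : ℝ) : ℂ) * fourier b y

lemma fourier_natCast (k : ℕ) (y : UnitAddCircle) : fourier (k : ℤ) y = (fourier 1 y : ℂ) ^ k := by
  induction k with
  | zero => simp
  | succ k ih => rw [Nat.cast_succ, fourier_add, ih, pow_succ]

lemma norm_fourier_apply (k : ℤ) (y : UnitAddCircle) : ‖(fourier k y : ℂ)‖ = 1 := by
  simp [fourier_apply, Circle.norm_coe]

lemma abs_stripCoeff (a b : ℤ) :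
    |(a : ℝ) / ((a : ℝ) ^ 2 + (b : ℝ) ^ 2)| = |(a : ℝ)| / (|(a : ℝ)| ^ 2 + (b : ℝ) ^ 2) := by
  rw [abs_div, sq_abs, abs_of_nonneg (by positivity : 0 ≤ (a : ℝ) ^ 2 + (b : ℝ) ^ 2)]

lemma one_le_abs_intCast {a : ℤ} (ha : a ≠ 0) : 1 ≤ |(a : ℝ)| := by
  exact_mod_cast Int.one_le_abs ha

lemma norm_stripSum_le (M : ℕ) {a : ℤ} (ha : a ≠ 0) (y : UnitAddCircle) :
    ‖stripSum M a y‖ ≤ 6 := by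
  refine (norm_sum_le _ _).trans ?_
  simp only [norm_mul, norm_fourier_apply, mul_one, Complex.norm_real, Real.norm_eq_abs,
    abs_stripCoeff]
  rw [sum_Icc_neg_eq fun b : ℤ => |(a : ℝ)| / (|(a : ℝ)| ^ 2 + (b : ℝ) ^ 2)]
  have h1 := sum_div_sq_add_sq_le (one_le_abs_intCast ha) (M + 1)
  have h2 : 0 ≤ |(a : ℝ)| / (|(a : ℝ)| ^ 2 + ((0 : ℤ) : ℝ) ^ 2) := by positivity
  simp only [Int.cast_natCast, Int.cast_neg, neg_sq]
  linarith

/-- Decay of `stripSum` away from `y = 0`, by Abel summation over `b ≥ 0` and `b ≤ 0`. -/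
lemma norm_one_sub_fourier_mul_stripSum_le (M : ℕ) {a : ℤ} (ha : a ≠ 0) (y : UnitAddCircle) :
    ‖1 - fourier 1 y‖ * ‖stripSum M a y‖ * |(a : ℝ)| ≤ 6 := by
  have ha1 := one_le_abs_intCast ha
  let b : ℕ → ℝ := fun k => |(a : ℝ)| / (|(a : ℝ)| ^ 2 + (k : ℝ) ^ 2)
  have hb : Antitone b := fun k l hkl => by
    simp only [b]
    gcongr
  have hb0 (k : ℕ) : 0 ≤ b k := by positivity
  let z : ℂ := fourier 1 y
  have hz : ‖z‖ = 1 := norm_fourier_apply 1 y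
  have hzc : ‖(starRingEnd ℂ) z‖ = 1 := by rw [Complex.norm_conj, hz]
  have h1 := norm_one_sub_mul_sum_le hb hb0 hz (M + 1)
  have h2 := norm_one_sub_mul_sum_le hb hb0 hzc (M + 1)
  have hconj : ‖1 - (starRingEnd ℂ) z‖ = ‖1 - z‖ := by
    rw [← Complex.norm_conj]
    simp
  have h3 : ‖1 - z‖ ≤ 2 := (norm_sub_le _ _).trans (by rw [norm_one, hz]; norm_num)
  obtain ⟨s, hs1, hs⟩ : ∃ s : ℝ, |s| = 1 ∧ (a : ℝ) = s * |(a : ℝ)| := by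
    rcases abs_choice (a : ℝ) with h | h
    · exact ⟨1, by simp, by linarith⟩
    · exact ⟨-1, by simp, by linarith⟩
  have h4 : stripSum M a y = (s : ℂ) * (∑ k ∈ Finset.range (M + 1), (b k : ℂ) * z ^ k
      + ∑ k ∈ Finset.range (M + 1), (b k : ℂ) * (starRingEnd ℂ) z ^ k - b 0) := by
    have h5 (k : ℤ) : (((a : ℝ) / ((a : ℝ) ^ 2 + (k : ℝ) ^ 2) : ℝ) : ℂ)
        = (s : ℂ) * ((|(a : ℝ)| / (|(a : ℝ)| ^ 2 + (k : ℝ) ^ 2) : ℝ) : ℂ) := by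
      rw [← Complex.ofReal_mul, ← mul_div_assoc, ← hs, sq_abs]
    rw [stripSum, sum_Icc_neg_eq fun b : ℤ =>
      ((a / ((a : ℝ) ^ 2 + (b : ℝ) ^ 2) : ℝ) : ℂ) * fourier b y]
    simp only [h5, fourier_neg, fourier_natCast, map_pow, mul_assoc, mul_sub, mul_add,
      Finset.mul_sum, fourier_zero, mul_one]
    simp [b, z]
  have hb0' : b 0 * |(a : ℝ)| = 1 := by
    simp only [b]
    field_simp
    simp
  calc ‖1 - z‖ * ‖stripSum M a y‖ * |(a : ℝ)|
      = ‖(1 - z) * (∑ k ∈ Finset.range (M + 1), (b k : ℂ) * z ^ k)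
        + (1 - z) * (∑ k ∈ Finset.range (M + 1), (b k : ℂ) * (starRingEnd ℂ) z ^ k)
        - (1 - z) * b 0‖ * |(a : ℝ)| := by
        rw [h4, norm_mul, Complex.norm_real, Real.norm_eq_abs, hs1, one_mul, ← norm_mul]
        congr 2
        ring
    _ ≤ (2 * b 0 + 2 * b 0 + 2 * b 0) * |(a : ℝ)| := by
        refine mul_le_mul_of_nonneg_right ?_ (abs_nonneg _)
        refine (norm_sub_le _ _).trans (add_le_add ((norm_add_le _ _).trans (add_le_add h1 ?_)) ?_)
        · rw [norm_mul, ← hconj, ← norm_mul]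
          exact h2
        · rw [norm_mul, Complex.norm_real, Real.norm_of_nonneg (hb0 0)]
          exact mul_le_mul_of_nonneg_right h3 (hb0 0)
    _ = 6 := by linear_combination 6 * hb0'

/-- Interpolation between the two bounds on `stripSum`. The exponent `5/4 > 1` makes the sum over
`a` converge, and the weight `σ^{3/8}` leaves an integrable power of `σ`. -/
lemma norm_stripSum_sq_mul_le (M : ℕ) {a : ℤ} (ha : a ≠ 0) (y : UnitAddCircle) :
    ‖stripSum M a y‖ ^ 2 * ‖1 - fourier 1 y‖ ^ (3 / 8 : ℝ)
      ≤ 36 * (|(a : ℝ)| ^ (-(5 / 4) : ℝ) * ‖1 - fourier 1 y‖ ^ (-(7 / 8) : ℝ)) := by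
  have ha1 := one_le_abs_intCast ha
  set σ := ‖1 - (fourier 1 y : ℂ)‖ with hσ
  rcases (norm_nonneg (1 - (fourier 1 y : ℂ))).eq_or_lt with h0 | h0
  · rw [hσ, ← h0, Real.zero_rpow (by norm_num), mul_zero]
    positivity
  rw [← hσ] at h0
  set X := ‖stripSum M a y‖ / 6 with hX
  have hX0 : 0 ≤ X := by positivity
  have hX1 : X ≤ 1 := by
    rw [hX, div_le_one (by norm_num)]
    exact norm_stripSum_le M ha y
  have hX2 : X ≤ (|(a : ℝ)| * σ)⁻¹ := by
    rw [← one_div, le_div_iff₀ (by positivity), hX]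
    have := norm_one_sub_fourier_mul_stripSum_le M ha y
    rw [← hσ] at this
    linarith
  have h1 : X ^ 2 ≤ (|(a : ℝ)| * σ) ^ (-(5 / 4) : ℝ) := by
    calc X ^ 2 = X ^ (2 : ℝ) := (Real.rpow_two X).symm
      _ ≤ X ^ (5 / 4 : ℝ) := by
        rcases hX0.eq_or_lt with h | h
        · rw [← h, Real.zero_rpow (by norm_num), Real.zero_rpow (by norm_num)]
        · exact Real.rpow_le_rpow_of_exponent_ge h hX1 (by norm_num)
      _ ≤ ((|(a : ℝ)| * σ)⁻¹) ^ (5 / 4 : ℝ) := Real.rpow_le_rpow hX0 hX2 (by norm_num)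
      _ = _ := by rw [Real.rpow_neg (by positivity), Real.inv_rpow (by positivity)]
  have h2 : ‖stripSum M a y‖ ^ 2 = 36 * X ^ 2 := by rw [hX]; ring
  rw [h2, mul_assoc]
  refine mul_le_mul_of_nonneg_left ?_ (by norm_num)
  calc X ^ 2 * σ ^ (3 / 8 : ℝ) ≤ (|(a : ℝ)| * σ) ^ (-(5 / 4) : ℝ) * σ ^ (3 / 8 : ℝ) := by gcongr
    _ = _ := by
      rw [Real.mul_rpow (abs_nonneg _) h0.le, mul_assoc, ← Real.rpow_add h0]
      norm_num

/-- Parseval's identity for trigonometric polynomials of one variable. -/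
lemma integral_norm_sq_sum_fourier (s : Finset ℤ) (c : ℤ → ℂ) :
    ∫ y : UnitAddCircle, ‖∑ a ∈ s, c a * fourier a y‖ ^ 2 ∂haarAddCircle = ∑ a ∈ s, ‖c a‖ ^ 2 := by
  have h1 := (orthonormal_fourier (T := (1 : ℝ))).inner_sum c c s
  have h2 : ∑ a ∈ s, c a • fourierLp (T := (1 : ℝ)) 2 a
      = ContinuousMap.toLp (E := ℂ) 2 haarAddCircle ℂ (∑ a ∈ s, c a • fourier a) := by
    simp [map_sum, fourierLp]
  rw [h2, ContinuousMap.inner_toLp] at h1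
  have h3 (z : ℂ) : (starRingEnd ℂ) z * z = ((‖z‖ ^ 2 : ℝ) : ℂ) := by
    rw [mul_comm, Complex.mul_conj, Complex.normSq_eq_norm_sq]
  simp only [mul_comm _ ((starRingEnd ℂ) _), h3, ContinuousMap.coe_sum, Finset.sum_apply,
    ContinuousMap.coe_smul, Pi.smul_apply, smul_eq_mul] at h1
  rw [integral_complex_ofReal, ← Complex.ofReal_sum] at h1
  exact_mod_cast h1

/-- Jordan's inequality. -/
lemma norm_one_sub_fourier_ge {t : ℝ} (ht : |t| ≤ 1 / 2) :
    4 * |t| ≤ ‖1 - (fourier 1 (t : UnitAddCircle) : ℂ)‖ := by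
  have h1 : (fourier 1 (t : UnitAddCircle) : ℂ)
      = Complex.exp (Complex.I * (2 * Real.pi * t : ℝ)) := by
    rw [fourier_coe_apply]
    congr 1
    push_cast
    ring
  rw [h1, norm_sub_rev, Complex.norm_exp_I_mul_ofReal_sub_one, norm_mul, Real.norm_eq_abs,
    Real.norm_eq_abs, abs_two]
  have h2 := Real.mul_abs_le_abs_sin (x := 2 * Real.pi * t / 2) (by
    rw [abs_div, abs_mul, abs_mul, abs_two, abs_of_pos Real.pi_pos]
    nlinarith [Real.pi_pos])
  have h3 : 2 / Real.pi * |2 * Real.pi * t / 2| = 2 * |t| := by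
    rw [abs_div, abs_mul, abs_mul, abs_two, abs_of_pos Real.pi_pos]
    field_simp
  linarith

lemma integrable_norm_one_sub_fourier_rpow {p : ℝ} (hp0 : 0 < p) (hp : p < 1) :
    Integrable (fun y : UnitAddCircle => ‖1 - (fourier 1 y : ℂ)‖ ^ (-p)) haarAddCircle := by
  have hmeas : Measurable fun y : UnitAddCircle => ‖1 - (fourier 1 y : ℂ)‖ ^ (-p) := by
    have : Continuous fun y : UnitAddCircle => ‖1 - (fourier 1 y : ℂ)‖ := by fun_prop
    exact this.measurable.pow_const _
  have hvol : (haarAddCircle : Measure UnitAddCircle) = volume := by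
    rw [volume_eq_smul_haarAddCircle]
    simp
  rw [hvol, ← (UnitAddCircle.measurePreserving_mk (-(1 / 2))).integrable_comp
    hmeas.aestronglyMeasurable]
  have hint : IntegrableOn (fun t : ℝ => |t| ^ (-p)) (Set.Ioc (-(1 / 2)) (-(1 / 2) + 1)) := by
    rw [← intervalIntegrable_iff_integrableOn_Ioc_of_le (by norm_num)]
    have h1 : IntervalIntegrable (fun t : ℝ => |t| ^ (-p)) volume 0 (1 / 2) := by
      refine (intervalIntegral.intervalIntegrable_rpow' (a := 0) (b := 1 / 2) (r := -p)
        (by linarith)).congr ?_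
      intro t ht
      rw [Set.uIoc_of_le (by norm_num)] at ht
      simp only [abs_of_pos ht.1]
    have h2 : IntervalIntegrable (fun t : ℝ => |t| ^ (-p)) volume (-(1 / 2)) 0 := by
      have := h1.comp_sub_left 0
      simpa using this.symm
    have h3 := h2.trans h1
    norm_num at h3 ⊢
    exact h3
  refine hint.mono' (hmeas.comp AddCircle.measurable_mk').aestronglyMeasurable ?_
  filter_upwards [ae_restrict_mem measurableSet_Ioc,
    (Measure.ae_ne (volume.restrict (Set.Ioc (-(1 / 2) : ℝ) (-(1 / 2) + 1))) 0)] with t ht ht0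
  have h4 : |t| ≤ 1 / 2 := abs_le.2 ⟨ht.1.le, by linarith [ht.2]⟩
  have h5 := norm_one_sub_fourier_ge h4
  have h6 : 0 < |t| := abs_pos.2 ht0
  rw [Function.comp_apply, Real.norm_of_nonneg (by positivity)]
  exact Real.rpow_le_rpow_of_nonpos h6 (by linarith) (by linarith)

end OneVariable

/-! ### The gradient of the velocity is bounded -/

section Kernel

open AddCircle

/-- The frequencies `k` with `|kᵢ| ≤ M`. -/
def freqBox (M : ℕ) : Finset (Fin 2 → ℤ) := Fintype.piFinset fun _ => Finset.Icc (-M : ℤ) M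

lemma tendsto_freqBox : Tendsto freqBox atTop atTop := by
  refine Filter.tendsto_atTop_finset_of_monotone (fun M N h => ?_) fun k => ?_
  · refine Fintype.piFinset_subset _ _ fun i => Finset.Icc_subset_Icc ?_ ?_ <;> simpa using h
  · refine ⟨(∑ i, |k i|).toNat, Fintype.mem_piFinset.2 fun i => ?_⟩
    have h1 := Finset.single_le_sum (fun j _ => abs_nonneg (k j)) (Finset.mem_univ i)
    have h2 := abs_le.1 h1
    rw [Finset.mem_Icc, Int.toNat_of_nonneg (Finset.sum_nonneg fun j _ => abs_nonneg (k j))]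
    exact h2

/-- The Fourier multiplier `kⱼ / |k|²`. -/
def rieszCoeff (j : Fin 2) (k : Fin 2 → ℤ) : ℝ := k j / ((k 0 : ℝ) ^ 2 + (k 1 : ℝ) ^ 2)

/-- The truncated kernel `∑ₖ kⱼ / |k|² e^{2πik·x}`, over `|kᵢ| ≤ M`. -/
def rieszKernel (j : Fin 2) (M : ℕ) (x : Torus2) : ℂ :=
  ∑ k ∈ freqBox M, (rieszCoeff j k : ℂ) * mFourier k x

lemma continuous_rieszKernel (j : Fin 2) (M : ℕ) : Continuous (rieszKernel j M) := by
  unfold rieszKernel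
  fun_prop

/-- Summation first over the frequency `k_{1-j}`. -/
lemma rieszKernel_eq (j : Fin 2) (M : ℕ) (x : Torus2) :
    rieszKernel j M x
      = ∑ a ∈ Finset.Icc (-M : ℤ) M, stripSum M a (x (1 - j)) * fourier a (x j) := by
  simp only [stripSum, Finset.sum_mul]
  rw [← Finset.sum_product']
  refine Finset.sum_nbij' (fun k => (k j, k (1 - j))) (fun p i => if i = j then p.1 else p.2)
    (fun k hk => ?_) (fun p hp => ?_) (fun k _ => ?_) (fun p _ => ?_) fun k _ => ?_
  · have := Fintype.mem_piFinset.1 hk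
    exact Finset.mem_product.2 ⟨this j, this (1 - j)⟩
  · have := Finset.mem_product.1 hp
    refine Fintype.mem_piFinset.2 fun i => ?_
    split_ifs
    · exact this.1
    · exact this.2
  · ext i
    fin_cases j <;> fin_cases i <;> simp
  · fin_cases j <;> simp
  · fin_cases j
    · simp [rieszCoeff, mFourier]
      ring
    · simp [rieszCoeff, mFourier, add_comm]
      ring

/-- Integration over the torus as an iterated integral, with the `j`-th coordinate inside. -/
lemma lintegral_torus_eq (j : Fin 2) {F : UnitAddCircle → UnitAddCircle → ℝ≥0∞}
    (hF : Measurable (Function.uncurry F)) :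
    ∫⁻ x, F (x j) (x (1 - j)) ∂torusMeasure
      = ∫⁻ y, ∫⁻ w, F w y ∂haarAddCircle ∂haarAddCircle := by
  have h := measurePreserving_piFinTwo fun _ : Fin 2 => (haarAddCircle : Measure UnitAddCircle)
  fin_cases j
  · have h1 := h.lintegral_comp (f := fun p => F p.1 p.2) hF
    simp only [MeasurableEquiv.piFinTwo_apply] at h1
    refine h1.trans ?_
    exact lintegral_prod_symm _ hF.aemeasurable
  · have hF' : Measurable fun p : UnitAddCircle × UnitAddCircle => F p.2 p.1 :=
      hF.comp measurable_swap
    have h1 := h.lintegral_comp (f := fun p => F p.2 p.1) hF'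
    simp only [MeasurableEquiv.piFinTwo_apply] at h1
    refine h1.trans ?_
    exact lintegral_prod _ hF'.aemeasurable

/-- The distance `|1 - e^{2πi y}|` of the coordinate `y = x_{1-j}` to zero. -/
def coordDist (j : Fin 2) (x : Torus2) : ℝ := ‖1 - (fourier 1 (x (1 - j)) : ℂ)‖

lemma continuous_coordDist (j : Fin 2) : Continuous (coordDist j) := by
  unfold coordDist
  fun_prop

lemma coordDist_nonneg (j : Fin 2) (x : Torus2) : 0 ≤ coordDist j x := norm_nonneg _

lemma integrable_coordDist_rpow (j : Fin 2) {p : ℝ} (hp0 : 0 < p) (hp : p < 1) :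
    Integrable (fun x => coordDist j x ^ (-p)) torusMeasure :=
  (measurePreserving_eval (fun _ : Fin 2 => (haarAddCircle : Measure UnitAddCircle))
    (1 - j)).integrable_comp_of_integrable (integrable_norm_one_sub_fourier_rpow hp0 hp)

/-- Parseval in one variable bounds the kernels on lines parallel to the `j`-th axis. -/
lemma integral_norm_sq_strip_le (M : ℕ) (y : UnitAddCircle) :
    (∫ w : UnitAddCircle, ‖∑ a ∈ Finset.Icc (-M : ℤ) M, stripSum M a y * fourier a w‖ ^ 2
        ∂haarAddCircle) * ‖1 - (fourier 1 y : ℂ)‖ ^ (3 / 8 : ℝ)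
      ≤ 36 * (∑' a : ℤ, |(a : ℝ)| ^ (-(5 / 4) : ℝ)) * ‖1 - (fourier 1 y : ℂ)‖ ^ (-(7 / 8) : ℝ) := by
  rw [integral_norm_sq_sum_fourier, Finset.sum_mul]
  calc _ ≤ ∑ a ∈ Finset.Icc (-M : ℤ) M, 36 * (|(a : ℝ)| ^ (-(5 / 4) : ℝ)
        * ‖1 - (fourier 1 y : ℂ)‖ ^ (-(7 / 8) : ℝ)) := by
        refine Finset.sum_le_sum fun a _ => ?_
        rcases eq_or_ne a 0 with rfl | ha
        · have : stripSum M 0 y = 0 := by simp [stripSum]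
          rw [this]
          simp only [norm_zero, ne_eq, OfNat.ofNat_ne_zero, not_false_eq_true, zero_pow, zero_mul]
          positivity
        · exact norm_stripSum_sq_mul_le M ha y
    _ = 36 * (∑ a ∈ Finset.Icc (-M : ℤ) M, |(a : ℝ)| ^ (-(5 / 4) : ℝ))
        * ‖1 - (fourier 1 y : ℂ)‖ ^ (-(7 / 8) : ℝ) := by
        rw [Finset.mul_sum, Finset.sum_mul]
        exact Finset.sum_congr rfl fun a _ => by ring
    _ ≤ _ := by
        have := (Real.summable_abs_int_rpow (b := 5 / 4) (by norm_num)).sum_le_tsum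
          (Finset.Icc (-M : ℤ) M) fun a _ => by positivity
        gcongr

/-- A bound for an integral over the torus from a bound for the integrals along an axis. -/
lemma integral_torus_le (j : Fin 2) {F : UnitAddCircle → UnitAddCircle → ℝ}
    (hF : Continuous (Function.uncurry F)) (hF0 : ∀ w y, 0 ≤ F w y) {G : UnitAddCircle → ℝ}
    (hG : Integrable G haarAddCircle) (h : ∀ y, ∫ w, F w y ∂haarAddCircle ≤ G y) :
    ∫ x, F (x j) (x (1 - j)) ∂torusMeasure ≤ ∫ y, G y ∂haarAddCircle := by
  have hG0 (y : UnitAddCircle) : 0 ≤ G y := (integral_nonneg fun w => hF0 w y).trans (h y)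
  have hj : Continuous fun x : Torus2 => F (x j) (x (1 - j)) :=
    hF.comp (by fun_prop : Continuous fun x : Torus2 => (x j, x (1 - j)))
  rw [integral_eq_lintegral_of_nonneg_ae (.of_forall fun x => hF0 _ _) hj.aestronglyMeasurable]
  refine ENNReal.toReal_le_of_le_ofReal (integral_nonneg hG0) ?_
  rw [lintegral_torus_eq j (F := fun w y => ENNReal.ofReal (F w y)) hF.measurable.ennreal_ofReal,
    ofReal_integral_eq_lintegral_ofReal hG (.of_forall hG0)]
  refine lintegral_mono fun y => ?_
  have hc : Continuous fun w => F w y := hF.comp (by fun_prop : Continuous fun w => (w, y))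
  have hi : Integrable (fun w => F w y) haarAddCircle :=
    hc.integrable_of_hasCompactSupport (HasCompactSupport.of_compactSpace _)
  rw [← ofReal_integral_eq_lintegral_ofReal hi (.of_forall fun w => hF0 w y)]
  exact ENNReal.ofReal_le_ofReal (h y)

lemma continuous_stripKernel (M : ℕ) :
    Continuous (Function.uncurry fun w y : UnitAddCircle =>
      ‖∑ a ∈ Finset.Icc (-M : ℤ) M, stripSum M a y * (fourier a w : ℂ)‖ ^ 2
        * ‖1 - (fourier 1 y : ℂ)‖ ^ (3 / 8 : ℝ)) := by
  have h1 (a : ℤ) : Continuous (stripSum M a) := by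
    unfold stripSum
    fun_prop
  have h2 : Continuous fun p : UnitAddCircle × UnitAddCircle => ‖1 - (fourier 1 p.2 : ℂ)‖ := by
    fun_prop
  have h3 : Continuous fun p : UnitAddCircle × UnitAddCircle =>
      ∑ a ∈ Finset.Icc (-M : ℤ) M, stripSum M a p.2 * (fourier a p.1 : ℂ) := by
    fun_prop
  exact (h3.norm.pow 2).mul (h2.rpow_const fun _ => Or.inr (by norm_num))

/-- The truncated kernels are bounded in a weighted `L²` space, uniformly in the truncation. -/
lemma exists_weighted_bound : ∃ C : ℝ, 0 ≤ C ∧ ∀ j M,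
    ∫ x, ‖rieszKernel j M x‖ ^ 2 * coordDist j x ^ (3 / 8 : ℝ) ∂torusMeasure ≤ C := by
  have hS : 0 ≤ ∑' a : ℤ, |(a : ℝ)| ^ (-(5 / 4) : ℝ) := tsum_nonneg fun a => by positivity
  refine ⟨∫ y : UnitAddCircle, 36 * (∑' a : ℤ, |(a : ℝ)| ^ (-(5 / 4) : ℝ))
    * ‖1 - (fourier 1 y : ℂ)‖ ^ (-(7 / 8) : ℝ) ∂haarAddCircle,
    integral_nonneg fun y => by positivity, fun j M => ?_⟩
  simp only [rieszKernel_eq, coordDist]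
  refine integral_torus_le j (F := fun w y =>
    ‖∑ a ∈ Finset.Icc (-M : ℤ) M, stripSum M a y * (fourier a w : ℂ)‖ ^ 2
      * ‖1 - (fourier 1 y : ℂ)‖ ^ (3 / 8 : ℝ)) (continuous_stripKernel M)
    (fun w y => by positivity)
    ((integrable_norm_one_sub_fourier_rpow (by norm_num) (by norm_num)).const_mul _) fun y => ?_
  rw [integral_mul_const]
  exact integral_norm_sq_strip_le M y

end Kernel

section Kernel

open AddCircle

lemma mFourier_apply_sub (k : Fin 2 → ℤ) (x y : Torus2) :
    mFourier k (x - y) = mFourier k x * mFourier (-k) y := by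
  have h : mFourier k (-y) = mFourier (-k) y := by
    simp [mFourier, fourier_apply]
  rw [sub_eq_add_neg, mFourier_apply_add, h]

/-- The weights are positive almost everywhere; at their zeros the negative powers take the junk
value `0`. -/
lemma ae_coordDist_pos (j : Fin 2) : ∀ᵐ x ∂torusMeasure, 0 < coordDist j x := by
  have h0 : ∀ᵐ y ∂(haarAddCircle : Measure UnitAddCircle), y ≠ 0 := by
    have hvol : (volume : Measure UnitAddCircle) = haarAddCircle := by
      rw [volume_eq_smul_haarAddCircle]
      simp
    have := AddCircle.volume_closedBall (1 : ℝ) (x := 0) 0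
    rw [ae_iff, ← hvol]
    simpa using this
  have h := (measurePreserving_eval (fun _ : Fin 2 => (haarAddCircle : Measure UnitAddCircle))
    (1 - j)).quasiMeasurePreserving.ae h0
  filter_upwards [h] with x hx
  refine norm_pos_iff.2 fun h => hx ?_
  have h1 : AddCircle.toCircle (x (1 - j)) = 1 := by
    have := (sub_eq_zero.1 h).symm
    rw [fourier_one] at this
    exact Circle.ext (this.trans Circle.coe_one.symm)
  exact AddCircle.injective_toCircle one_ne_zero (h1.trans AddCircle.toCircle_zero.symm)

/-- Young's inequality with weights, `ab ≤ a⁴/4 + s^{-3/4}/4 + b² s^{3/8}/2`. -/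
lemma mul_le_weighted {a b s : ℝ} (hs : 0 < s) :
    a * b ≤ a ^ 4 / 4 + s ^ (-(3 / 4) : ℝ) / 4 + b ^ 2 * s ^ (3 / 8 : ℝ) / 2 := by
  have ht : 0 < s ^ (3 / 8 : ℝ) := Real.rpow_pos_of_pos hs _
  have h : s ^ (-(3 / 4) : ℝ) = ((s ^ (3 / 8 : ℝ))⁻¹) ^ 2 := by
    rw [← Real.rpow_neg hs.le, ← Real.rpow_natCast, ← Real.rpow_mul hs.le]
    norm_num
  rw [h]
  set t := s ^ (3 / 8 : ℝ)
  have h1 : a * b ≤ a ^ 2 * t⁻¹ / 2 + b ^ 2 * t / 2 := by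
    have h2 : a ^ 2 * t⁻¹ / 2 + b ^ 2 * t / 2 - a * b = (a - b * t) ^ 2 * t⁻¹ / 2 := by
      field_simp
      ring
    have : 0 ≤ (a - b * t) ^ 2 * t⁻¹ / 2 := by positivity
    linarith
  nlinarith [sq_nonneg (a ^ 2 - t⁻¹)]

/-- Convolution with the truncated kernels maps `L⁴` to `L^∞`, uniformly in the truncation. -/
theorem exists_kernel_bound : ∃ C : ℝ, 0 < C ∧ ∀ (j : Fin 2) (M : ℕ) (f : Torus2 → ℝ),
    MemLp f 4 torusMeasure → ∀ x,
      ‖∑ k ∈ freqBox M, (rieszCoeff j k : ℂ) * realCoeff f k * mFourier k x‖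
        ≤ C * lpNorm f 4 torusMeasure := by
  obtain ⟨C₀, hC₀, hbound⟩ := exists_weighted_bound
  let D : Fin 2 → ℝ := fun j => ∫ x, coordDist j x ^ (-(3 / 4) : ℝ) ∂torusMeasure
  have hD (j : Fin 2) : 0 ≤ D j := integral_nonneg fun x => by
    have := coordDist_nonneg j x
    positivity
  refine ⟨1 / 4 + (D 0 + D 1) / 4 + C₀ / 2, by have := hD 0; have := hD 1; positivity,
    fun j M f hf x => ?_⟩
  have hDj : D j ≤ D 0 + D 1 := by
    have := hD 0; have := hD 1
    fin_cases j <;> simp <;> linarith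
  -- The truncated series is the convolution of `f` with the truncated kernel.
  have hconv (f : Torus2 → ℝ) (hf : MemLp f 4 torusMeasure) :
      ∑ k ∈ freqBox M, (rieszCoeff j k : ℂ) * realCoeff f k * mFourier k x
        = ∫ y, (f y : ℂ) * rieszKernel j M (x - y) ∂torusMeasure := by
    have hfi := hf.integrable (by norm_num)
    simp only [rieszKernel, Finset.mul_sum, mFourier_apply_sub]
    rw [integral_finsetSum]
    · refine Finset.sum_congr rfl fun k _ => ?_
      rw [realCoeff_eq, mul_right_comm, ← integral_const_mul]
      exact integral_congr_ae (.of_forall fun y => by ring)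
    · intro k _
      refine ((integrable_mul_mFourier hfi (-k)).const_mul
        ((rieszCoeff j k : ℂ) * mFourier k x)).congr (.of_forall fun y => ?_)
      simp only
      ring
  -- By homogeneity it suffices to treat functions in the unit ball of `L⁴`.
  have hunit (f : Torus2 → ℝ) (hf : MemLp f 4 torusMeasure) (hf1 : lpNorm f 4 torusMeasure ≤ 1) :
      ‖∑ k ∈ freqBox M, (rieszCoeff j k : ℂ) * realCoeff f k * mFourier k x‖
        ≤ 1 / 4 + (D 0 + D 1) / 4 + C₀ / 2 := by
    have : torusMeasure.IsNegInvariant := Measure.pi.isNegInvariant _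
    rw [hconv f hf, ← integral_sub_left_eq_self _ torusMeasure x]
    simp only [sub_sub_cancel]
    have hmp : MeasurePreserving (fun y => x - y) torusMeasure torusMeasure :=
      Measure.measurePreserving_sub_left torusMeasure x
    have hf4 : Integrable (fun y => |f (x - y)| ^ 4) torusMeasure :=
      hmp.integrable_comp_of_integrable (integrable_norm_pow_four_of_memLp hf)
    have hσ := integrable_coordDist_rpow j (p := 3 / 4) (by norm_num) (by norm_num)
    have hN : Integrable (fun y => ‖rieszKernel j M y‖ ^ 2 * coordDist j y ^ (3 / 8 : ℝ))
        torusMeasure :=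
      Continuous.integrable_of_hasCompactSupport (((continuous_rieszKernel j M).norm.pow 2).mul
        ((continuous_coordDist j).rpow_const fun _ => Or.inr (by norm_num)))
        (HasCompactSupport.of_compactSpace _)
    refine (norm_integral_le_of_norm_le (((hf4.div_const 4).add (hσ.div_const 4)).add
      (hN.div_const 2)) ?_).trans ?_
    · filter_upwards [ae_coordDist_pos j] with y hy
      rw [norm_mul, Complex.norm_real, Real.norm_eq_abs]
      exact mul_le_weighted hy
    · rw [integral_add' ((hf4.div_const 4).add (hσ.div_const 4)) (hN.div_const 2),
        integral_add' (hf4.div_const 4) (hσ.div_const 4), integral_div, integral_div, integral_div]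
      have h1 : ∫ y, |f (x - y)| ^ 4 ∂torusMeasure ≤ 1 := by
        rw [integral_sub_left_eq_self (fun y => |f y| ^ 4) torusMeasure x]
        have := lpNorm_four_pow hf.aestronglyMeasurable
        simp only [Real.norm_eq_abs] at this
        rw [← this]
        exact pow_le_one₀ lpNorm_nonneg hf1
      have h2 := hbound j M
      have h3 : ∫ y, coordDist j y ^ (-(3 / 4) : ℝ) ∂torusMeasure ≤ D 0 + D 1 := hDj
      linarith
  have hC : 0 < 1 / 4 + (D 0 + D 1) / 4 + C₀ / 2 := by
    have := hD 0; have := hD 1; positivity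
  set C := 1 / 4 + (D 0 + D 1) / 4 + C₀ / 2
  refine le_of_forall_pos_le_add fun ε hε => ?_
  have ht : 0 < lpNorm f 4 torusMeasure + ε / C :=
    add_pos_of_nonneg_of_pos lpNorm_nonneg (by positivity)
  set t := lpNorm f 4 torusMeasure + ε / C with ht_def
  have h := hunit (t⁻¹ • f) (hf.const_smul _) (by
    rw [lpNorm_const_smul, coe_nnnorm, Real.norm_of_nonneg (by positivity), inv_mul_le_one₀ ht,
      ht_def]
    have : 0 < ε / C := by positivity
    linarith)
  have hlin (k : Fin 2 → ℤ) : realCoeff (t⁻¹ • f) k = (t⁻¹ : ℂ) * realCoeff f k := by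
    rw [realCoeff_eq, realCoeff_eq, ← integral_const_mul]
    refine integral_congr_ae (.of_forall fun y => ?_)
    simp only [Pi.smul_apply, smul_eq_mul]
    push_cast
    ring
  have hsum : ∑ k ∈ freqBox M, (rieszCoeff j k : ℂ) * realCoeff (t⁻¹ • f) k * mFourier k x
      = (t⁻¹ : ℂ) * ∑ k ∈ freqBox M, (rieszCoeff j k : ℂ) * realCoeff f k * mFourier k x := by
    rw [Finset.mul_sum]
    exact Finset.sum_congr rfl fun k _ => by rw [hlin]; ring
  rw [hsum, norm_mul, norm_inv, Complex.norm_real, Real.norm_of_nonneg ht.le,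
    inv_mul_le_iff₀ ht] at h
  refine h.trans (le_of_eq ?_)
  rw [ht_def]
  field_simp

end Kernel

/-! ### The truncated velocity -/

/-- The velocity `K * ξ`, with the Fourier series truncated to the frequencies `|kᵢ| ≤ M`. -/
def truncVel (ξ : Torus2 → ℝ) (M : ℕ) (j : Fin 2) : Torus2 → ℝ :=
  trigSum (freqBox M) fun k => biotSavartCoeff j k * realCoeff ξ k

lemma smoothTorus_truncVel (ξ : Torus2 → ℝ) (M : ℕ) (j : Fin 2) : SmoothTorus (truncVel ξ M j) :=
  smoothTorus_trigSum _ _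

/-- The truncated velocity is incompressible, since `k · k^⊥ = 0`. -/
lemma sum_torusPartial_truncVel (ξ : Torus2 → ℝ) (M : ℕ) (x : Torus2) :
    ∑ j, torusPartial j (truncVel ξ M j) x = 0 := by
  simp only [truncVel, torusPartial_trigSum, trigSum]
  rw [← Complex.re_sum, ← Finset.sum_comm]
  rw [Finset.sum_eq_zero, Complex.zero_re]
  intro k _
  simp only [Fin.sum_univ_two, biotSavartCoeff, perp, Matrix.cons_val_zero, Matrix.cons_val_one]
  push_cast
  ring

/-- The constants relating the Biot–Savart multiplier to the multipliers `kⱼ / |k|²`. -/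
def biotSavartConst (j : Fin 2) : ℂ := ![1, -1] j * Complex.I / (2 * Real.pi)

lemma norm_biotSavartConst_le (j : Fin 2) : ‖biotSavartConst j‖ ≤ 1 := by
  have h : ‖biotSavartConst j‖ = 1 / (2 * Real.pi) := by
    fin_cases j <;> simp [biotSavartConst, abs_of_pos Real.pi_pos]
  rw [h, div_le_one (by positivity)]
  linarith [Real.pi_gt_three]

lemma biotSavartCoeff_eq (j : Fin 2) (k : Fin 2 → ℤ) :
    biotSavartCoeff j k = biotSavartConst j * rieszCoeff (1 - j) k := by
  fin_cases j <;>
    simp [biotSavartCoeff, biotSavartConst, rieszCoeff, perp, div_eq_mul_inv] <;> ring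

lemma abs_rieszCoeff_le (j : Fin 2) (k : Fin 2 → ℤ) : |rieszCoeff j k| ≤ 1 := by
  rw [rieszCoeff, abs_div]
  refine div_le_one_of_le₀ ?_ (abs_nonneg _)
  have h (j : Fin 2) : |(k j : ℝ)| ≤ (k j : ℝ) ^ 2 := by
    have : |k j| ≤ k j ^ 2 := by
      rw [← sq_abs]
      exact Int.le_self_sq _
    exact_mod_cast this
  rw [abs_of_nonneg (by positivity : 0 ≤ (k 0 : ℝ) ^ 2 + (k 1 : ℝ) ^ 2)]
  have h0 := sq_nonneg (k 0 : ℝ)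
  have h1 := sq_nonneg (k 1 : ℝ)
  have hj := h j
  fin_cases j <;> simp only [Fin.zero_eta, Fin.mk_one] at hj ⊢ <;> linarith

lemma norm_biotSavartCoeff_le (j : Fin 2) (k : Fin 2 → ℤ) : ‖biotSavartCoeff j k‖ ≤ 1 := by
  rw [biotSavartCoeff_eq, norm_mul, Complex.norm_real]
  exact mul_le_one₀ (norm_biotSavartConst_le j) (norm_nonneg _) (abs_rieszCoeff_le _ k)

/-- The gradient of the truncated velocity is bounded by the `L⁴` norm of `∇ξ`: the derivative
falls on `ξ`, and the truncated kernels map `L⁴` to `L^∞` uniformly. -/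
theorem exists_torusPartial_truncVel_bound : ∃ C : ℝ, 0 < C ∧
    ∀ (ξ : Torus2 → ℝ) (γ : Torus2 → Vec2), HasWeakGradient ξ γ → MemLp γ 4 torusMeasure →
      ∀ M i j x, |torusPartial i (truncVel ξ M j) x| ≤ C * lpNorm γ 4 torusMeasure := by
  obtain ⟨C, hC, h⟩ := exists_kernel_bound
  refine ⟨C, hC, fun ξ γ hξγ hγ M i j x => ?_⟩
  have h1 : ∑ k ∈ freqBox M,
      2 * Real.pi * Complex.I * k i * (biotSavartCoeff j k * realCoeff ξ k) * mFourier k x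
      = biotSavartConst j * ∑ k ∈ freqBox M,
        (rieszCoeff (1 - j) k : ℂ) * realCoeff (fun x => γ x i) k * mFourier k x := by
    rw [Finset.mul_sum]
    refine Finset.sum_congr rfl fun k _ => ?_
    rw [hξγ.realCoeff_apply, biotSavartCoeff_eq]
    ring
  rw [truncVel, torusPartial_trigSum, trigSum, h1]
  refine (Complex.abs_re_le_norm _).trans ?_
  rw [norm_mul]
  refine (mul_le_of_le_one_left (norm_nonneg _) (norm_biotSavartConst_le j)).trans ?_
  refine (h _ M _ (memLp_apply hγ i) x).trans ?_
  have := lpNorm_le_of_norm_le (f := fun x => γ x i) zero_le_one (memLp_apply hγ i).1 hγ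
    fun x => by simpa using PiLp.norm_apply_le (γ x) i
  rw [one_mul] at this
  gcongr

/-- The Fourier series of `K * ξ` converges in `L²`, so that the sum in `biotSavart` is genuine. -/
lemma hasSum_biotSavart {ξ : Torus2 → ℝ} (hξ : MemLp ξ 2 torusMeasure) (j : Fin 2) :
    HasSum (fun k => (biotSavartCoeff j k * realCoeff ξ k) •
        (mFourierLp 2 k : Lp ℂ 2 torusMeasure))
      (∑' k, (biotSavartCoeff j k * realCoeff ξ k) •
        (mFourierLp 2 k : Lp ℂ 2 torusMeasure)) := by
  have hξc : MemLp (fun x => (ξ x : ℂ)) 2 torusMeasure := hξ.ofReal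
  have h1 := (hasSum_sq_mFourierCoeff (d := Fin 2) (hξc.toLp _)).summable
  have h2 (k : Fin 2 → ℤ) : mFourierCoeff (hξc.toLp _) k = realCoeff ξ k := by
    refine integral_congr_ae ?_
    filter_upwards [hξc.coeFn_toLp] with x hx
    rw [hx]
  simp only [h2] at h1
  have h3 : Memℓp (fun k => biotSavartCoeff j k * realCoeff ξ k) 2 := by
    refine memℓp_gen ?_
    simp only [ENNReal.toReal_ofNat, Real.rpow_ofNat]
    refine h1.of_nonneg_of_le (fun k => by positivity) fun k => ?_
    rw [norm_mul]
    gcongr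
    exact mul_le_of_le_one_left (norm_nonneg _) (norm_biotSavartCoeff_le j k)
  have h4 := (mFourierBasis (d := Fin 2)).hasSum_repr_symm ⟨_, h3⟩
  simp only [coe_mFourierBasis] at h4
  exact h4.summable.hasSum

lemma biotSavart_apply (ξ : Torus2 → ℝ) (x : Torus2) (j : Fin 2) :
    biotSavart ξ x j = ((∑' k, (biotSavartCoeff j k * realCoeff ξ k) •
      (mFourierLp 2 k : Lp ℂ 2 torusMeasure)) x).re := rfl

lemma memLp_biotSavart_apply (ξ : Torus2 → ℝ) (j : Fin 2) :
    MemLp (fun x => biotSavart ξ x j) 2 torusMeasure := by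
  simp only [biotSavart_apply]
  have h : MemLp (∑' k, (biotSavartCoeff j k * realCoeff ξ k) •
      (mFourierLp 2 k : Lp ℂ 2 torusMeasure) : Lp ℂ 2 torusMeasure) 2 torusMeasure := Lp.memLp _
  exact h.re

lemma tendsto_truncVel {ξ : Torus2 → ℝ} (hξ : MemLp ξ 2 torusMeasure) (j : Fin 2) :
    Tendsto (fun M => lpNorm (truncVel ξ M j - fun x => biotSavart ξ x j) 2 torusMeasure) atTop
      (𝓝 0) := by
  simp only [biotSavart_apply]
  exact (lpNorm_trigSum_sub_tendsto (hasSum_biotSavart hξ j)).comp tendsto_freqBox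

/-! ### Existence -/

lemma integrable_mul_of_memLp_two {f w : Torus2 → ℝ} (hf : MemLp f 2 torusMeasure)
    (hw : MemLp w 2 torusMeasure) : Integrable (fun x => f x * w x) torusMeasure :=
  hf.integrable_mul hw

/-- Products of weakly and strongly convergent sequences converge in the mean. -/
lemma tendsto_integral_mul_of_weakTendsto {ι : Type*} {U : Filter ι} {G w : ι → Torus2 → ℝ}
    {g u : Torus2 → ℝ} (hG : ∀ n, MemLp (G n) 2 torusMeasure) {K : ℝ}
    (hGK : ∀ n, lpNorm (G n) 2 torusMeasure ≤ K) (hGg : WeakTendsto G U g)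
    (hw : ∀ n, MemLp (w n) 2 torusMeasure) (hu : MemLp u 2 torusMeasure)
    (hwu : Tendsto (fun n => lpNorm (w n - u) 2 torusMeasure) U (𝓝 0)) :
    Tendsto (fun n => ∫ x, G n x * w n x ∂torusMeasure) U (𝓝 (∫ x, g x * u x ∂torusMeasure)) := by
  have h1 : Tendsto (fun n => ∫ x, G n x * (w n - u) x ∂torusMeasure) U (𝓝 0) := by
    refine squeeze_zero_norm (fun n => ?_) (by simpa using hwu.const_mul K)
    exact (abs_integral_mul_le (hG n) ((hw n).sub hu)).trans
      (mul_le_mul_of_nonneg_right (hGK n) lpNorm_nonneg)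
  have h2 := (hGg.integral_mul hu).add h1
  rw [add_zero] at h2
  refine h2.congr fun n => ?_
  rw [← integral_add (integrable_mul_of_memLp_two (hG n) hu)
    (integrable_mul_of_memLp_two (hG n) ((hw n).sub hu))]
  exact integral_congr_ae (.of_forall fun x => by simp only [Pi.sub_apply]; ring)

lemma SmoothTorus.memLp_mul {φ u : Torus2 → ℝ} (hφ : SmoothTorus φ) (hu : MemLp u 2 torusMeasure) :
    MemLp (fun x => u x * φ x) 2 torusMeasure := by
  obtain ⟨C, -, hC⟩ := hφ.exists_bound
  refine hu.of_le_mul (c := C) (hu.1.mul hφ.continuous.aestronglyMeasurable)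
    (.of_forall fun x => ?_)
  rw [norm_mul, mul_comm]
  exact mul_le_mul_of_nonneg_right (hC x) (norm_nonneg _)

lemma SmoothTorus.tendsto_lpNorm_mul_sub {ι : Type*} {U : Filter ι} {w : ι → Torus2 → ℝ}
    {φ u : Torus2 → ℝ} (hφ : SmoothTorus φ) (hw : ∀ n, MemLp (w n) 2 torusMeasure)
    (hu : MemLp u 2 torusMeasure)
    (hwu : Tendsto (fun n => lpNorm (w n - u) 2 torusMeasure) U (𝓝 0)) :
    Tendsto (fun n => lpNorm ((fun x => w n x * φ x) - fun x => u x * φ x) 2 torusMeasure) U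
      (𝓝 0) := by
  obtain ⟨C, hC0, hC⟩ := hφ.exists_bound
  refine squeeze_zero (fun _ => lpNorm_nonneg) (fun n => ?_) (by simpa using hwu.const_mul C)
  refine lpNorm_le_of_norm_le hC0 ((hφ.memLp_mul (hw n)).sub (hφ.memLp_mul hu)).1
    ((hw n).sub hu) fun x => ?_
  rw [Pi.sub_apply, ← sub_mul, norm_mul, mul_comm]
  exact mul_le_mul_of_nonneg_right (hC x) (norm_nonneg _)

/-- The solutions for the truncated velocities converge weakly to a solution for `K * ξ`; in the
transport term the velocities converge strongly in `L²`. -/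
theorem exists_solution {ξ : Torus2 → ℝ} {γ : Torus2 → Vec2} {L τ : ℝ}
    (hL : ∀ M i j x, |torusPartial i (truncVel ξ M j) x| ≤ L) (hτ : 0 < τ) (hs : 6 * τ * L < 1)
    (hξγ : HasWeakGradient ξ γ) (hξ : MemLp ξ 4 torusMeasure) (hγ : MemLp γ 4 torusMeasure) :
    ∃ f : Torus2 → ℝ, ∃ g : Torus2 → Vec2, HasWeakGradient f g ∧ MemLp f 4 torusMeasure ∧
      MemLp g 4 torusMeasure ∧
      lpNorm f 4 torusMeasure ≤ lpNorm ξ 4 torusMeasure / (1 - 6 * τ * L) ∧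
      lpNorm g 4 torusMeasure ≤ lpNorm γ 4 torusMeasure / (1 - 6 * τ * L) ∧
      ∀ᵐ x ∂torusMeasure, f x + τ * ∑ i, biotSavart ξ x i * g x i = ξ x := by
  choose F G hFG hF hG hFle hGle heq using fun M =>
    exists_solution_smooth (smoothTorus_truncVel ξ M) (hL M) hτ hs hξγ hξ hγ
  have hs' : 0 < 1 - 6 * τ * L := by linarith
  have hF2 (n : ℕ) : MemLp (F n) 2 torusMeasure := memLp_two_of_four (hF n)
  have hG2 (n : ℕ) : MemLp (G n) 2 torusMeasure := memLp_two_of_four (hG n)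
  have hGle2 (n : ℕ) := (lpNorm_two_le_four (hG n)).trans (hGle n)
  obtain ⟨f, hf2, hFf⟩ := exists_weakTendsto (hyperfilter ℕ) hF2
    fun n => (lpNorm_two_le_four (hF n)).trans (hFle n)
  obtain ⟨g, hg2, hGg⟩ := exists_weakTendsto (hyperfilter ℕ) hG2 hGle2
  obtain ⟨hf, hfle⟩ := hFf.lpNorm_four_le hf2 (div_nonneg lpNorm_nonneg hs'.le) hF hFle
  obtain ⟨hg, hgle⟩ := hGg.lpNorm_four_le hg2 (div_nonneg lpNorm_nonneg hs'.le) hG hGle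
  refine ⟨f, g, hFf.hasWeakGradient hGg hf2 hg2 hFG, hf, hg, hfle, hgle, ?_⟩
  have hu (i : Fin 2) := memLp_biotSavart_apply ξ i
  have hui (i : Fin 2) : Integrable (fun x => biotSavart ξ x i * g x i) torusMeasure :=
    (hu i).integrable_mul (memLp_apply hg2 i)
  have hsi : Integrable (fun x => ∑ i, biotSavart ξ x i * g x i) torusMeasure :=
    integrable_finsetSum _ fun i _ => hui i
  refine ae_eq_of_forall_smooth ((hf2.integrable (by norm_num)).add (hsi.const_mul τ))
    (hξ.integrable (by norm_num)) fun φ hφ => ?_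
  have hsplit {v : Fin 2 → Torus2 → ℝ} {f : Torus2 → ℝ} {g : Torus2 → Vec2}
      (hv : ∀ i, MemLp (v i) 2 torusMeasure) (hf : MemLp f 2 torusMeasure)
      (hg : MemLp g 2 torusMeasure) :
      ∫ x, (f x + τ * ∑ i, v i x * g x i) * φ x ∂torusMeasure
        = ∫ x, f x * φ x ∂torusMeasure
          + τ * ∑ i, ∫ x, g x i * (v i x * φ x) ∂torusMeasure := by
    have h1 (i : Fin 2) : Integrable (fun x => g x i * (v i x * φ x)) torusMeasure :=
      (memLp_apply hg i).integrable_mul (hφ.memLp_mul (hv i))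
    rw [← integral_finsetSum _ fun i _ => h1 i, ← integral_const_mul,
      ← integral_add (hφ.integrable_mul (hf.integrable (by norm_num)))
      ((integrable_finsetSum _ fun i _ => h1 i).const_mul τ)]
    refine integral_congr_ae (.of_forall fun x => ?_)
    simp only [add_mul, mul_assoc, Finset.sum_mul]
    congr 2
    exact Finset.sum_congr rfl fun i _ => by ring
  have hv (n : ℕ) (i : Fin 2) : MemLp (truncVel ξ n i) 2 torusMeasure :=
    (smoothTorus_truncVel ξ n i).memLp 2
  have hlim : Tendsto (fun n => ∫ x, (F n x + τ * ∑ i, truncVel ξ n i x * G n x i) * φ x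
      ∂torusMeasure) (hyperfilter ℕ)
      (𝓝 (∫ x, (f x + τ * ∑ i, biotSavart ξ x i * g x i) * φ x ∂torusMeasure)) := by
    rw [hsplit hu hf2 hg2]
    refine ((hFf.integral_mul (hφ.memLp 2)).add ((tendsto_finsetSum _ fun i _ => ?_).const_mul
      τ)).congr fun n => (hsplit (hv n) (hF2 n) (hG2 n)).symm
    have h1 : Tendsto (fun n => lpNorm (truncVel ξ n i - fun x => biotSavart ξ x i) 2 torusMeasure)
        (hyperfilter ℕ) (𝓝 0) :=
      (tendsto_truncVel (memLp_two_of_four hξ) i).mono_left Nat.hyperfilter_le_atTop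
    refine tendsto_integral_mul_of_weakTendsto
      (K := lpNorm γ 4 torusMeasure / (1 - 6 * τ * L)) (fun n => memLp_apply (hG2 n) i)
      (fun n => ?_) (hGg.apply i) (fun n => hφ.memLp_mul (hv n i)) (hφ.memLp_mul (hu i))
      (hφ.tendsto_lpNorm_mul_sub (fun n => hv n i) (hu i) h1)
    refine le_trans ?_ (hGle2 n)
    simpa using lpNorm_le_of_norm_le zero_le_one (memLp_apply (hG2 n) i).1 (hG2 n)
      fun x => by simpa using PiLp.norm_apply_le (G n x) i
  refine tendsto_nhds_unique hlim (tendsto_const_nhds.congr fun n => ?_)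
  refine integral_congr_ae ?_
  filter_upwards [heq n] with x hx
  rw [hx]

/-! ### Transport by the velocity preserves the mean and the `L²` norm -/

section Incompressible

variable {f : Torus2 → ℝ} {g : Torus2 → Vec2}

lemma transportDual_eq {v : Fin 2 → Torus2 → ℝ} (hv : ∀ i, SmoothTorus (v i))
    (hdiv : ∀ x, ∑ i, torusPartial i (v i) x = 0) {φ : Torus2 → ℝ} (hφ : SmoothTorus φ)
    (x : Torus2) : transportDual v φ x = -∑ i, v i x * torusPartial i φ x := by
  simp only [transportDual, SmoothTorus.torusPartial_mul (hv _) hφ, Finset.sum_add_distrib,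
    ← Finset.sum_mul, hdiv, zero_mul, zero_add]

/-- Integration by parts against the components of the field. -/
lemma HasWeakGradient.integral_transport_eq_zero (h : HasWeakGradient f g)
    {v : Fin 2 → Torus2 → ℝ} (hv : ∀ i, SmoothTorus (v i))
    (hdiv : ∀ x, ∑ i, torusPartial i (v i) x = 0) :
    ∫ x, ∑ i, v i x * g x i ∂torusMeasure = 0 := by
  have h1 := h.integral_mul_transportDual hv (SmoothTorus.const 1)
  simp only [transportDual_eq hv hdiv (SmoothTorus.const 1), mul_one] at h1
  rw [← h1]
  simp [torusPartial]

/-- Transport by a smooth incompressible field is skew-symmetric: integrate by parts against the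
Fourier partial sums of `f`, whose gradients are the Fourier partial sums of `g`. -/
lemma HasWeakGradient.integral_transport_mul_self_eq_zero (h : HasWeakGradient f g)
    (hf : MemLp f 2 torusMeasure) (hg : MemLp g 2 torusMeasure)
    {v : Fin 2 → Torus2 → ℝ} (hv : ∀ i, SmoothTorus (v i))
    (hdiv : ∀ x, ∑ i, torusPartial i (v i) x = 0) :
    ∫ x, (∑ i, v i x * g x i) * f x ∂torusMeasure = 0 := by
  have hgi (i : Fin 2) : MemLp (fun x => g x i) 2 torusMeasure := memLp_apply hg i
  have hvg : MemLp (fun x => ∑ i, v i x * g x i) 2 torusMeasure := by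
    refine memLp_finsetSum _ fun i _ => ?_
    simpa only [mul_comm] using (hv i).memLp_mul (hgi i)
  have hs (s : Finset (Fin 2 → ℤ)) :
      ∫ x, trigSum s (realCoeff f) x * ∑ i, v i x * g x i ∂torusMeasure
        = -∑ i, ∫ x, trigSum s (realCoeff fun x => g x i) x * (f x * v i x) ∂torusMeasure := by
    have h1 := h.integral_mul_transportDual hv (smoothTorus_trigSum s (realCoeff f))
    simp only [transportDual_eq hv hdiv (smoothTorus_trigSum s (realCoeff f)),
      torusPartial_trigSum, ← h.realCoeff_apply] at h1
    simp only [mul_comm (trigSum s (realCoeff f) _)]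
    rw [← h1, ← integral_finsetSum, ← integral_neg]
    · refine integral_congr_ae (.of_forall fun x => ?_)
      simp only [mul_neg, Finset.mul_sum]
      exact congrArg _ (Finset.sum_congr rfl fun i _ => by ring)
    · exact fun i _ => ((smoothTorus_trigSum s _).memLp 2).integrable_mul ((hv i).memLp_mul hf)
  have hl := tendsto_integral_mul (fun s => (smoothTorus_trigSum s (realCoeff f)).memLp 2) hf hvg
    (lpNorm_trigSum_realCoeff_sub_tendsto hf)
  simp only [hs] at hl
  have hr := (tendsto_finsetSum Finset.univ fun i _ => tendsto_integral_mul
    (fun s => (smoothTorus_trigSum s (realCoeff fun x => g x i)).memLp 2) (hgi i)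
    ((hv i).memLp_mul hf) (lpNorm_trigSum_realCoeff_sub_tendsto (hgi i))).neg
  have heq := tendsto_nhds_unique hl hr
  rw [← integral_finsetSum _ fun i _ =>
    integrable_mul_of_memLp_two (hgi i) ((hv i).memLp_mul hf)] at heq
  have h1 : ∫ x, f x * ∑ i, v i x * g x i ∂torusMeasure
      = ∫ x, (∑ i, v i x * g x i) * f x ∂torusMeasure :=
    integral_congr_ae (.of_forall fun x => mul_comm _ _)
  have h2 : ∫ x, ∑ i, g x i * (f x * v i x) ∂torusMeasure
      = ∫ x, (∑ i, v i x * g x i) * f x ∂torusMeasure := by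
    refine integral_congr_ae (.of_forall fun x => ?_)
    simp only [Finset.sum_mul]
    exact Finset.sum_congr rfl fun i _ => by ring
  rw [h1, h2] at heq
  linarith

lemma tendsto_integral_truncVel {ξ : Torus2 → ℝ} (hξ : MemLp ξ 2 torusMeasure)
    {w : Fin 2 → Torus2 → ℝ} (hw : ∀ i, MemLp (w i) 2 torusMeasure) :
    Tendsto (fun M => ∫ x, ∑ i, truncVel ξ M i x * w i x ∂torusMeasure) atTop
      (𝓝 (∫ x, ∑ i, biotSavart ξ x i * w i x ∂torusMeasure)) := by
  have hM (M : ℕ) (i : Fin 2) := (smoothTorus_truncVel ξ M i).memLp 2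
  rw [integral_finsetSum _ fun i _ =>
    integrable_mul_of_memLp_two (memLp_biotSavart_apply ξ i) (hw i)]
  refine (tendsto_finsetSum _ fun i _ => tendsto_integral_mul (fun M => hM M i)
    (memLp_biotSavart_apply ξ i) (hw i) (tendsto_truncVel hξ i)).congr fun M => ?_
  rw [integral_finsetSum _ fun i _ => integrable_mul_of_memLp_two (hM M i) (hw i)]

lemma HasWeakGradient.integral_biotSavart_eq_zero (h : HasWeakGradient f g)
    (hg : MemLp g 2 torusMeasure) {ξ : Torus2 → ℝ} (hξ : MemLp ξ 2 torusMeasure) :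
    ∫ x, ∑ i, biotSavart ξ x i * g x i ∂torusMeasure = 0 := by
  refine tendsto_nhds_unique (tendsto_integral_truncVel hξ fun i => memLp_apply hg i)
    (tendsto_const_nhds.congr fun M => (h.integral_transport_eq_zero
      (smoothTorus_truncVel ξ M) (sum_torusPartial_truncVel ξ M)).symm)

lemma HasWeakGradient.integral_biotSavart_mul_self_eq_zero (h : HasWeakGradient f g)
    (hf : MemLp f 4 torusMeasure) (hg : MemLp g 4 torusMeasure) {ξ : Torus2 → ℝ}
    (hξ : MemLp ξ 2 torusMeasure) :
    ∫ x, (∑ i, biotSavart ξ x i * g x i) * f x ∂torusMeasure = 0 := by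
  have : ENNReal.HolderTriple 4 4 2 := ⟨by
    rw [← ENNReal.toReal_eq_toReal_iff' (by simp) (by simp), ENNReal.toReal_add (by simp) (by simp)]
    norm_num⟩
  have hw (i : Fin 2) : MemLp (fun x => g x i * f x) 2 torusMeasure :=
    hf.mul (memLp_apply hg i)
  have h1 := tendsto_integral_truncVel hξ hw
  have h2 (M : ℕ) := h.integral_transport_mul_self_eq_zero (memLp_two_of_four hf)
    (memLp_two_of_four hg) (smoothTorus_truncVel ξ M) (sum_torusPartial_truncVel ξ M)
  simp only [Finset.sum_mul, mul_assoc] at h2 ⊢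
  simp only [h2] at h1
  exact tendsto_nhds_unique h1 tendsto_const_nhds

end Incompressible

/-! ### Strong solutions -/

lemma HasWeakGradient.normW14_eq {f : Torus2 → ℝ} {g : Torus2 → Vec2} (h : HasWeakGradient f g)
    (hf : MemLp f 4 torusMeasure) (hg : MemLp g 4 torusMeasure) :
    normW14 f = (lpNorm f 4 torusMeasure ^ 4 + lpNorm g 4 torusMeasure ^ 4) ^ (1 / 4 : ℝ) := by
  rw [lpNorm_four_pow hf.1, lpNorm_four_pow hg.1, normW14]
  congr 2
  refine integral_congr_ae ?_
  filter_upwards [h.weakGradient_ae_eq] with x hx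
  rw [hx]

/-- The difference `D` of two solutions satisfies `D² = -τ (u · ∇D) D`, which has integral zero. -/
lemma IsStrongSolution.ae_unique {τ : ℝ} {ξ Φ Ψ : Torus2 → ℝ} (hξ : MemLp ξ 2 torusMeasure)
    (hΦ : IsStrongSolution τ ξ Φ) (hΨ : IsStrongSolution τ ξ Ψ) : Ψ =ᵐ[torusMeasure] Φ := by
  obtain ⟨⟨hΦ4, g, hg, hg4⟩, -, heq⟩ := hΦ
  obtain ⟨⟨hΨ4, g', hg', hg'4⟩, -, heq'⟩ := hΨ
  have hD : MemLp (fun x => Ψ x - Φ x) 4 torusMeasure := hΨ4.sub hΦ4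
  have h0 := (hg'.sub hg).integral_biotSavart_mul_self_eq_zero hD (hg'4.sub hg4) hξ
  have hD2 : ∫ x, (Ψ x - Φ x) ^ 2 ∂torusMeasure = 0 := by
    rw [← mul_zero (-τ), ← h0, ← integral_const_mul]
    refine integral_congr_ae ?_
    filter_upwards [heq, heq', hg.weakGradient_ae_eq, hg'.weakGradient_ae_eq] with x h1 h2 h3 h4
    rw [h3] at h1
    rw [h4] at h2
    have h5 : Ψ x - Φ x = -τ * ∑ i, biotSavart ξ x i * (g' x - g x) i := by
      simp only [PiLp.sub_apply, mul_sub, Finset.sum_sub_distrib]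
      linear_combination h2 - h1
    rw [← mul_assoc, ← h5, sq]
  have h1 := (integral_eq_zero_iff_of_nonneg (fun x => sq_nonneg _)
    (memLp_two_of_four hD).integrable_sq).1 hD2
  filter_upwards [h1] with x hx
  exact sub_eq_zero.1 (pow_eq_zero_iff two_ne_zero |>.1 hx)

/-- A solution of the transport equation has the same mean as the right-hand side. -/
lemma HasWeakGradient.integral_eq_of_transport_eq {τ : ℝ} {ξ f : Torus2 → ℝ} {g : Torus2 → Vec2}
    (h : HasWeakGradient f g) (hg : MemLp g 2 torusMeasure) (hξ : MemLp ξ 2 torusMeasure)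
    (heq : ∀ᵐ x ∂torusMeasure, f x + τ * ∑ i, biotSavart ξ x i * g x i = ξ x) :
    ∫ x, f x ∂torusMeasure = ∫ x, ξ x ∂torusMeasure := by
  have hi : Integrable (fun x => ∑ i, biotSavart ξ x i * g x i) torusMeasure :=
    integrable_finsetSum _ fun i _ =>
      integrable_mul_of_memLp_two (memLp_biotSavart_apply ξ i) (memLp_apply hg i)
  rw [← integral_congr_ae heq, integral_add h.1 (hi.const_mul τ), integral_const_mul,
    h.integral_biotSavart_eq_zero hg hξ, mul_zero, add_zero]

/-- Bernoulli's inequality converts the bounds of the solution operator on `f` and `∇f` into a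
bound with exponent `-1/4`. -/
lemma rpow_four_le_of_le_div {a b A B s t : ℝ} (ha0 : 0 ≤ a) (hb0 : 0 ≤ b)
    (hs : 4 * s ≤ t) (ht : t < 1)
    (ha : a ≤ A / (1 - s)) (hb : b ≤ B / (1 - s)) :
    (a ^ 4 + b ^ 4) ^ (1 / 4 : ℝ) ≤ (1 - t) ^ (-(1 / 4) : ℝ) * (A ^ 4 + B ^ 4) ^ (1 / 4 : ℝ) := by
  have ht' : 0 < 1 - t := by linarith
  have hs' : 0 < 1 - s := by linarith
  have hpow : 1 - t ≤ (1 - s) ^ 4 := by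
    have := one_add_mul_le_pow (a := -s) (by linarith) 4
    push_cast at this
    rw [← sub_eq_add_neg] at this
    linarith
  have h : a ^ 4 + b ^ 4 ≤ (1 - t)⁻¹ * (A ^ 4 + B ^ 4) := by
    have h1 := pow_le_pow_left₀ ha0 ha 4
    have h2 := pow_le_pow_left₀ hb0 hb 4
    rw [div_pow] at h1 h2
    calc a ^ 4 + b ^ 4 ≤ (A ^ 4 + B ^ 4) / (1 - s) ^ 4 := by rw [add_div]; linarith
      _ ≤ (A ^ 4 + B ^ 4) / (1 - t) := by gcongr
      _ = _ := by rw [div_eq_inv_mul]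
  calc (a ^ 4 + b ^ 4) ^ (1 / 4 : ℝ) ≤ ((1 - t)⁻¹ * (A ^ 4 + B ^ 4)) ^ (1 / 4 : ℝ) := by gcongr
    _ = _ := by
      rw [Real.mul_rpow (by positivity) (by positivity), Real.inv_rpow ht'.le,
        Real.rpow_neg ht'.le]

end

theorem mainTheorem8 :
    ∃ C : ℝ, 0 < C ∧
      ∀ ξ : Torus2 → ℝ, MemW14 ξ → MemE ξ →
        ∀ τ : ℝ, 0 < τ → C * τ * normW14 ξ < 1 →
          ∃ Φ : Torus2 → ℝ, IsStrongSolution τ ξ Φ ∧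
            (∀ Ψ : Torus2 → ℝ, IsStrongSolution τ ξ Ψ → Ψ =ᵐ[torusMeasure] Φ) ∧
            normW14 Φ ≤ (1 - C * τ * normW14 ξ) ^ (-(1 / 4) : ℝ) * normW14 ξ := by
  obtain ⟨C, hC, hbound⟩ := exists_torusPartial_truncVel_bound
  -- Existence needs `6 * τ * C * |∇ξ|₄ < 1`; Bernoulli's inequality costs a further factor `4`.
  refine ⟨24 * C, by positivity, fun ξ hξW hξE τ hτ hsmall => ?_⟩
  obtain ⟨hξ4, γ, hγ, hγ4⟩ := hξW
  have hN := hγ.normW14_eq hξ4 hγ4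
  have hγN : lpNorm γ 4 torusMeasure ≤ normW14 ξ := by
    rw [hN]
    calc lpNorm γ 4 torusMeasure = (lpNorm γ 4 torusMeasure ^ 4) ^ (1 / 4 : ℝ) := by
          rw [← Real.rpow_natCast, ← Real.rpow_mul lpNorm_nonneg]
          norm_num
      _ ≤ _ := by
          gcongr
          exact le_add_of_nonneg_left (by positivity)
  have hs : 4 * (6 * τ * (C * lpNorm γ 4 torusMeasure)) ≤ 24 * C * τ * normW14 ξ := by
    have := mul_le_mul_of_nonneg_left hγN (by positivity : 0 ≤ 24 * C * τ)
    linarith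
  have hs1 : 6 * τ * (C * lpNorm γ 4 torusMeasure) < 1 := by
    have : 0 ≤ 6 * τ * (C * lpNorm γ 4 torusMeasure) :=
      mul_nonneg (by positivity) (mul_nonneg hC.le lpNorm_nonneg)
    linarith
  obtain ⟨f, g, hfg, hf4, hg4, hfle, hgle, heq⟩ := exists_solution
    (fun M i j x => hbound ξ γ hγ hγ4 M i j x) hτ hs1 hγ hξ4 hγ4
  have hf : IsStrongSolution τ ξ f := by
    refine ⟨⟨hf4, g, hfg, hg4⟩, ⟨memLp_two_of_four hf4, ?_⟩, ?_⟩
    · rw [hfg.integral_eq_of_transport_eq (memLp_two_of_four hg4) hξE.1 heq, hξE.2]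
    · filter_upwards [heq, hfg.weakGradient_ae_eq] with x hx hgx
      rw [hgx, ← hx]
      ring
  refine ⟨f, hf, fun Ψ hΨ => hf.ae_unique hξE.1 hΨ, ?_⟩
  rw [hfg.normW14_eq hf4 hg4]
  refine (rpow_four_le_of_le_div lpNorm_nonneg lpNorm_nonneg hs hsmall hfle hgle).trans ?_
  rw [← hN]
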